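/- Let $k,l$ be non-zero coprime integers, $m=-k-l$, and suppose that $\{k,l,m\}$ is neither $\{1,1,-2\}$ nor $\{1,-1,0\}$ (as multisets). Let $W_{k,l}=SU(3)/S^1_{k,l}$ be the Aloff–Wallach space, where $S^1_{k,l}=\{\mathrm{diag}(e^{ik\theta},e^{il\theta},e^{im\theta}):\theta\in\mathbb R\}$. Put $s=\sqrt{(k^2+l^2+m^2)/6}$ and let $e^0,\dots,e^7$ be the left-invariant 1-forms on $SU(3)$ for which the Maurer–Cartan form is $$\frac1{\sqrt2}\begin{pmatrix} i\big(\tfrac{k}{\sqrt3 s}e^0+\tfrac{l-m}{3s}e^4\big)& e^1+ie^5&-e^3+ie^7\\ -e^1+ie^5& i\big(\tfrac{l}{\sqrt3 s}e^0+\tfrac{m-k}{3s}e^4\big)&e^2+ie^6\\ e^3+ie^7&-e^2+ie^6& i\big(\tfrac{m}{\sqrt3 s}e^0+\tfrac{k-l}{3s}e^4\big)\end{pmatrix}.$$ For non-zero real constants $A,B,C,D$ let $$\varphi_W=ABC(e^{123}-e^{167}+e^{257}-e^{356})-D(A^2e^{15}+B^2e^{26}+C^2e^{37})\wedge e^4,$$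 a $G_2$-structure on $W_{k,l}$ whose metric $g$ has orthonormal coframe $Ae^1,Be^2,Ce^3,De^4,Ae^5,Be^6,Ce^7$. Assume that $\varphi_W$ is nearly parallel, i.e. $d\varphi_W=\tau_0\star\varphi_W$ for some real $\tau_0\neq0$, where $\star$ is the Hodge star of the metric and orientation determined by $\varphi_W$. For $j=1,2,3$ let $\pi_j:W_{k,l}\to\mathbb{CP}^2$ send the coset of $g\in SU(3)$ to the complex line spanned by the $j$-th column of $g$; $\pi_3=\pi_{k,l}$ is the canonical fibration $SU(3)/S^1_{k,l}\to SU(3)/U(2)\cong\mathbb{CP}^2$. 1. Every fibre of $\pi_{k,l}$ is an embedded 3-dimensional submanifold of $W_{k,l}$ which is minimal for $g$ and associative, i.e. (for a suitable orientation) $\varphi_W$ restricts to its Riemannian volume form. 2. For each of $j=1,2,3$ the fibres of $\pi_j$ form a smooth family, parametrised by the 4-manifold $\mathbb{CP}^2$, of pairwise disjoint embedded minimal associative 3-folds, all diffeomorphic to the spherical space form $S^3/\mathbb Z_p$ (with $\mathbb Z_p$ acting on $S^3\subset\mathbb C^2$ by multiplication by $p$-th roots of unity), where $p=|k|,|l|,|k+l|$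 for $j=1,2,3$ respectively. The three families are different: no fibre of $\pi_i$ is a fibre of $\pi_j$ for $i\ne j$. If moreover $|k|,|l|,|k+l|$ are pairwise distinct, then no fibre of $\pi_i$ is even homeomorphic to a fibre of $\pi_j$ for $i\neq j$. -/

import Mathlib

open scoped Manifold ContDiff LinearAlgebra.Projectivization ComplexConjugate

noncomputable section

namespace AloffWallach

/-! ### Euclidean model spaces -/

abbrev E3 := EuclideanSpace ℝ (Fin 3)
abbrev E4 := EuclideanSpace ℝ (Fin 4)
abbrev E7 := EuclideanSpace ℝ (Fin 7)

/-- The unit sphere `S³ ⊂ ℝ⁴ = ℂ²`, with Mathlib's smooth structure. -/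
abbrev S3 := Metric.sphere (0 : EuclideanSpace ℝ (Fin (3 + 1))) 1

/-! ### Linear algebra of `G₂`-forms on a 7-dimensional space -/

section LinearAlgebra

variable {V : Type*} [AddCommGroup V] [Module ℝ V] [TopologicalSpace V]

/-- The determinant as a continuous alternating form on `ℝᵖ`. -/
def detForm (p : ℕ) : (Fin p → ℝ) [⋀^Fin p]→L[ℝ] ℝ :=
  { (Matrix.detRowAlternating : (Fin p → ℝ) [⋀^Fin p]→ₗ[ℝ] ℝ) with
    cont := by
      change Continuous fun M : Matrix (Fin p) (Fin p) ℝ => M.det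
      exact continuous_id.matrix_det }

/-- The wedge product `α₀ ∧ ⋯ ∧ α_{p-1}` of 1-forms: `(v₀, …) ↦ det (αⱼ(vᵢ))`. -/
def wedge {p : ℕ} (α : Fin p → V →L[ℝ] ℝ) : V [⋀^Fin p]→L[ℝ] ℝ :=
  (detForm p).compContinuousLinearMap (ContinuousLinearMap.pi α)

theorem wedge_apply {p : ℕ} (α : Fin p → V →L[ℝ] ℝ) (v : Fin p → V) :
    wedge α v = (Matrix.of fun i j => α j (v i)).det := rfl

/-- The model `G₂` 3-form of a coframe `η¹, …, η⁷`,
`η¹²⁷ + η³⁴⁷ + η⁵⁶⁷ + η¹³⁵ - η¹⁴⁶ - η²³⁶ - η²⁴⁵`.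
A `G₂`-structure is a 3-form which has this expression in some coframe `η` near each point.
Since the stabiliser `G₂` of the model form lies in `SO(7)`, the Riemannian metric
`∑ ηⁱ ⊗ ηⁱ` and the volume form `η¹²³⁴⁵⁶⁷` are determined by the 3-form. -/
def g2Form (η : Fin 7 → V →L[ℝ] ℝ) : V [⋀^Fin 3]→L[ℝ] ℝ :=
  wedge ![η 0, η 1, η 6] + wedge ![η 2, η 3, η 6] + wedge ![η 4, η 5, η 6]
    + wedge ![η 0, η 2, η 4] - wedge ![η 0, η 3, η 5] - wedge ![η 1, η 2, η 5]
    - wedge ![η 1, η 3, η 4]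

/-- The inner product for which the coframe `η` is orthonormal. -/
def coframeInner (η : Fin 7 → V →L[ℝ] ℝ) (u v : V) : ℝ := ∑ i, η i u * η i v

/-- The Hodge star of a 3-form `α`, evaluated on four vectors, for the metric with orthonormal
coframe `η`, volume form `η¹ ∧ ⋯ ∧ η⁷`, and `E` the frame dual to `η`:
`(⋆α)(v₀, …, v₃) = (1/3!) ∑ α(Eᵢ, Eⱼ, Eₖ) vol(Eᵢ, Eⱼ, Eₖ, v₀, …, v₃)`,
so that `⋆η¹²³ = η⁴⁵⁶⁷`. -/
def hodgeStar (η : Fin 7 → V →L[ℝ] ℝ) (E : Fin 7 → V) (α : V [⋀^Fin 3]→L[ℝ] ℝ)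
    (v : Fin 4 → V) : ℝ :=
  (1 / 6) * ∑ i, ∑ j, ∑ k,
    α ![E i, E j, E k] * wedge η ![E i, E j, E k, v 0, v 1, v 2, v 3]

end LinearAlgebra

/-! ### The spaces `W_{k,l}` -/

/-- The group `SU(3)`. -/
abbrev SU3 := Matrix.specialUnitaryGroup (Fin 3) ℂ

/-- The weights `(k, l, m)` with `m = -k - l`. -/
def weight (k l : ℤ) : Fin 3 → ℤ := ![k, l, -k - l]

/-- The circle subgroup `S¹_{k,l} = {diag(e^{ikθ}, e^{ilθ}, e^{imθ})}` of `SU(3)`. -/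
def circle (k l : ℤ) : Subgroup SU3 where
  carrier := {h | ∃ θ : ℝ, (h : Matrix (Fin 3) (Fin 3) ℂ) =
    Matrix.diagonal fun j => Complex.exp (Complex.I * (weight k l j : ℂ) * (θ : ℂ))}
  one_mem' := ⟨0, by simp⟩
  mul_mem' := by
    rintro a b ⟨s, hs⟩ ⟨t, ht⟩
    refine ⟨s + t, ?_⟩
    rw [Submonoid.coe_mul, hs, ht, Matrix.diagonal_mul_diagonal]
    congr 1
    funext j
    rw [← Complex.exp_add]
    congr 1
    push_cast
    ring
  inv_mem' := by
    rintro a ⟨s, hs⟩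
    refine ⟨-s, ?_⟩
    change star (a : Matrix (Fin 3) (Fin 3) ℂ) = _
    rw [hs, Matrix.star_eq_conjTranspose, Matrix.diagonal_conjTranspose]
    congr 1
    funext j
    simp [← Complex.exp_conj]

/-- The Aloff–Wallach space `W_{k,l} = SU(3) / S¹_{k,l}`, with the quotient topology. Its smooth
structure is the one for which `SU(3) → W_{k,l}` is a submersion (a principal circle bundle). -/
abbrev W (k l : ℤ) := SU3 ⧸ circle k l

/-- The `j`-th column of a special unitary matrix is nonzero. -/
theorem col_ne_zero (g : SU3) (j : Fin 3) :
    (fun i => (g : Matrix (Fin 3) (Fin 3) ℂ) i j) ≠ 0 := by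
  intro h
  have hdet : (g : Matrix (Fin 3) (Fin 3) ℂ).det = 1 :=
    (Matrix.mem_specialUnitaryGroup_iff.1 g.2).2
  rw [Matrix.det_eq_zero_of_column_eq_zero j (fun i => congrFun h i)] at hdet
  exact zero_ne_one hdet

/-- The complex projective plane. -/
abbrev CP2 := ℙ ℂ (Fin 3 → ℂ)

/-- The projection `W_{k,l} → ℂP²` taking the coset of `g` to the line spanned by the `j`-th column
of `g`, i.e. the map `SU(3)/S¹_{k,l} → SU(3)/U(2) ≅ ℂP²` for the subgroup `U(2)` of `SU(3)`
stabilising the `j`-th coordinate line. For `j = 2` (the last column) the matrices in `U(2)` are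
block-diagonal with a 2×2 block followed by a 1×1 block, and this is the canonical fibration
`π_{k,l}`. -/
def proj (k l : ℤ) (j : Fin 3) : W k l → CP2 :=
  Quotient.lift (s := QuotientGroup.leftRel (circle k l))
    (fun g : SU3 => Projectivization.mk ℂ
      (fun i => (g : Matrix (Fin 3) (Fin 3) ℂ) i j) (col_ne_zero g j)) (by
    intro a b hab
    obtain ⟨θ, hθ⟩ := QuotientGroup.leftRel_apply.1 hab
    rw [Projectivization.mk_eq_mk_iff']
    refine ⟨Complex.exp (-(Complex.I * (weight k l j : ℂ) * (θ : ℂ))), ?_⟩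
    have hb : (b : Matrix (Fin 3) (Fin 3) ℂ) = (a : Matrix (Fin 3) (Fin 3) ℂ) *
        Matrix.diagonal fun j => Complex.exp (Complex.I * (weight k l j : ℂ) * (θ : ℂ)) := by
      rw [← hθ, ← Submonoid.coe_mul, mul_inv_cancel_left]
    funext i
    simp only [Pi.smul_apply, smul_eq_mul, hb, Matrix.mul_diagonal]
    rw [mul_comm, mul_assoc, ← Complex.exp_add, add_neg_cancel, Complex.exp_zero, mul_one])

/-- The fibre of the `j`-th projection over `x`. -/
def fibre (k l : ℤ) (j : Fin 3) (x : CP2) : Set (W k l) := proj k l j ⁻¹' {x}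

/-! ### The left-invariant coframe and the 3-forms `φ_W` -/

section Forms

variable {V : Type*} [AddCommGroup V] [Module ℝ V] [TopologicalSpace V]

/-- The value `g⁻¹ dg` of the Maurer–Cartan form, entry by entry, when the differential at a point
of an `SU(3)`-valued map with value `g` there is `dg`. -/
def maurerCartan (g : SU3) (dg : Fin 3 → Fin 3 → V →L[ℝ] ℂ) : Fin 3 → Fin 3 → V →L[ℝ] ℂ :=
  fun i j => ∑ r, conj ((g : Matrix (Fin 3) (Fin 3) ℂ) r i) • dg r j

/-- `s = √((k² + l² + m²)/6)`. -/
def sNorm (k l : ℤ) : ℝ := √((∑ j, (weight k l j : ℝ) ^ 2) / 6)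

/-- The integers `(l - m, m - k, k - l)`. -/
def coweight (k l : ℤ) : Fin 3 → ℤ :=
  ![weight k l 1 - weight k l 2, weight k l 2 - weight k l 0, weight k l 0 - weight k l 1]

/-- The 1-forms `e¹, …, e⁷` (in this order, indexed from `0`), as components of a Maurer–Cartan
form `Ω`; see `maurerCartan_eq`. -/
def coframe (k l : ℤ) (Ω : Fin 3 → Fin 3 → V →L[ℝ] ℂ) : Fin 7 → V →L[ℝ] ℝ :=
  ![√2 • Complex.reCLM.comp (Ω 0 1), √2 • Complex.reCLM.comp (Ω 1 2),
    √2 • Complex.reCLM.comp (Ω 2 0),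
    (√2 / (6 * sNorm k l)) • ∑ j, (coweight k l j : ℝ) • Complex.imCLM.comp (Ω j j),
    √2 • Complex.imCLM.comp (Ω 0 1), √2 • Complex.imCLM.comp (Ω 1 2),
    √2 • Complex.imCLM.comp (Ω 2 0)]

/-- The remaining 1-form `e⁰`, dual to the circle direction. -/
def coframeZero (k l : ℤ) (Ω : Fin 3 → Fin 3 → V →L[ℝ] ℂ) : V →L[ℝ] ℝ :=
  (√2 * √3 / (6 * sNorm k l)) • ∑ j, (weight k l j : ℝ) • Complex.imCLM.comp (Ω j j)

/-- On `𝔰𝔲(3)`-valued 1-forms `Ω`, the `eⁱ` are the components in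
`Ω = (1/√2) (i((k/√3s)e⁰ + ((l-m)/3s)e⁴), e¹ + ie⁵, -e³ + ie⁷; …)`. -/
theorem maurerCartan_eq (k l : ℤ) (hk : k ≠ 0) (Ω : Fin 3 → Fin 3 → V →L[ℝ] ℂ) (v : V)
    (hskew : ∀ i j, Ω i j v = -conj (Ω j i v)) (htr : ∑ i, Ω i i v = 0) :
    let s : ℝ := sNorm k l
    let m : ℤ := -k - l
    let e₀ : ℝ := coframeZero k l Ω v
    let e : Fin 7 → ℝ := fun a => coframe k l Ω a v
    (Matrix.of fun i j => Ω i j v) = ((1 / √2 : ℝ) : ℂ) •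
      !![Complex.I * ((k / (√3 * s) * e₀ + (l - m) / (3 * s) * e 3 : ℝ) : ℂ),
          e 0 + Complex.I * e 4, -e 2 + Complex.I * e 6;
        -e 0 + Complex.I * e 4,
          Complex.I * ((l / (√3 * s) * e₀ + (m - k) / (3 * s) * e 3 : ℝ) : ℂ),
          e 1 + Complex.I * e 5;
        e 2 + Complex.I * e 6, -e 1 + Complex.I * e 5,
          Complex.I * ((m / (√3 * s) * e₀ + (k - l) / (3 * s) * e 3 : ℝ) : ℂ)] := by
  intro s m e₀ e
  have h2 : √2 * √2 = (2 : ℝ) := Real.mul_self_sqrt (by norm_num)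
  have h2' : √2 ≠ 0 := by positivity
  have h3' : √3 ≠ 0 := by positivity
  have hk' : (0 : ℝ) < (k : ℝ) ^ 2 := by positivity
  have hs2 : s ^ 2 = ((k : ℝ) ^ 2 + (l : ℝ) ^ 2 + (-k - l : ℝ) ^ 2) / 6 := by
    simp only [s, sNorm]
    rw [Real.sq_sqrt (by positivity)]
    simp [weight, Fin.sum_univ_three]
  have hs : s ≠ 0 := by
    intro h
    rw [h] at hs2
    nlinarith [sq_nonneg (l : ℝ), sq_nonneg (-k - l : ℝ)]
  have him : (Ω 0 0 v).im + (Ω 1 1 v).im + (Ω 2 2 v).im = 0 := by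
    simpa [Fin.sum_univ_three] using congrArg Complex.im htr
  have hre : ∀ i, (Ω i i v).re = 0 := fun i => by
    have := congrArg Complex.re (hskew i i)
    simp at this
    linarith
  have he₀ : e₀ = (√2 * √3 / (6 * s)) *
      (k * (Ω 0 0 v).im + l * (Ω 1 1 v).im + (-k - l) * (Ω 2 2 v).im) := by
    simp [e₀, coframeZero, weight, Fin.sum_univ_three, s]
    ring
  have he3 : e 3 = (√2 / (6 * s)) * ((l - (-k - l)) * (Ω 0 0 v).im
      + ((-k - l) - k) * (Ω 1 1 v).im + (k - l) * (Ω 2 2 v).im) := by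
    simp [e, coframe, coweight, weight, Fin.sum_univ_three, s]
    ring
  have hm : (m : ℝ) = -k - l := by simp [m]
  have hd2 : (Ω 2 2 v).im = -(Ω 0 0 v).im - (Ω 1 1 v).im := by linarith
  have d0 : (1 / √2) * (k / (√3 * s) * e₀ + (l - m) / (3 * s) * e 3) = (Ω 0 0 v).im := by
    rw [he₀, he3, hm, hd2]
    field_simp
    rw [hs2]
    ring
  have d1 : (1 / √2) * (l / (√3 * s) * e₀ + (m - k) / (3 * s) * e 3) = (Ω 1 1 v).im := by
    rw [he₀, he3, hm, hd2]
    field_simp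
    rw [hs2]
    ring
  have d2 : (1 / √2) * (m / (√3 * s) * e₀ + (k - l) / (3 * s) * e 3) = (Ω 2 2 v).im := by
    rw [he₀, he3, hm, hd2]
    field_simp
    rw [hs2]
    ring
  have g0 : e 0 = √2 * (Ω 0 1 v).re := by simp [e, coframe]
  have g1 : e 1 = √2 * (Ω 1 2 v).re := by simp [e, coframe]
  have g2 : e 2 = √2 * (Ω 2 0 v).re := by simp [e, coframe]
  have g4 : e 4 = √2 * (Ω 0 1 v).im := by simp [e, coframe]
  have g5 : e 5 = √2 * (Ω 1 2 v).im := by simp [e, coframe]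
  have g6 : e 6 = √2 * (Ω 2 0 v).im := by simp [e, coframe]
  clear_value e e₀
  generalize k / (√3 * s) * e₀ + (l - m) / (3 * s) * e 3 = a₀ at d0 ⊢
  generalize l / (√3 * s) * e₀ + (m - k) / (3 * s) * e 3 = a₁ at d1 ⊢
  generalize m / (√3 * s) * e₀ + (k - l) / (3 * s) * e 3 = a₂ at d2 ⊢
  ext i j
  rw [Matrix.smul_apply, smul_eq_mul]
  apply Complex.ext
  · rw [Complex.re_ofReal_mul]
    fin_cases i <;> fin_cases j <;>
      simp [hre, g0, g1, g2, h2', hskew 1 0, hskew 2 1, hskew 0 2]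
  · rw [Complex.im_ofReal_mul]
    fin_cases i <;> fin_cases j <;>
      simp [-one_div, d0, d1, d2, g4, g5, g6, hskew 1 0, hskew 2 1, hskew 0 2] <;>
      field_simp

/-- The coframe `Ae¹, Be², Ce³, De⁴, Ae⁵, Be⁶, Ce⁷`. -/
def scaledCoframe (k l : ℤ) (A B C D : ℝ) (Ω : Fin 3 → Fin 3 → V →L[ℝ] ℂ) :
    Fin 7 → V →L[ℝ] ℝ :=
  fun a => (![A, B, C, D, A, B, C] : Fin 7 → ℝ) a • coframe k l Ω a

/-- The 3-form `φ_W = ABC (e¹²³ - e¹⁶⁷ + e²⁵⁷ - e³⁵⁶) - D (A² e¹⁵ + B² e²⁶ + C² e³⁷) ∧ e⁴`. -/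
def phiW (k l : ℤ) (A B C D : ℝ) (Ω : Fin 3 → Fin 3 → V →L[ℝ] ℂ) : V [⋀^Fin 3]→L[ℝ] ℝ :=
  let e := coframe k l Ω
  (A * B * C) • (wedge ![e 0, e 1, e 2] - wedge ![e 0, e 5, e 6] + wedge ![e 1, e 4, e 6]
      - wedge ![e 2, e 4, e 5])
    - D • (A ^ 2 • wedge ![e 0, e 4, e 3] + B ^ 2 • wedge ![e 1, e 5, e 3]
      + C ^ 2 • wedge ![e 2, e 6, e 3])

/-- The coframe `Ae¹, Ae⁵, Be², Be⁶, Ce³, Ce⁷, -De⁴`, in which `φ_W` is the model `G₂`-form, see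
`phiW_eq_g2Form`. Hence it is an oriented orthonormal coframe for the metric and orientation
determined by `φ_W`. -/
def adaptedCoframe (k l : ℤ) (A B C D : ℝ) (Ω : Fin 3 → Fin 3 → V →L[ℝ] ℂ) :
    Fin 7 → V →L[ℝ] ℝ :=
  let ε := scaledCoframe k l A B C D Ω
  ![ε 0, ε 4, ε 1, ε 5, ε 2, ε 6, -ε 3]

theorem phiW_eq_g2Form (k l : ℤ) (A B C D : ℝ) (Ω : Fin 3 → Fin 3 → V →L[ℝ] ℂ) :
    phiW k l A B C D Ω = g2Form (adaptedCoframe k l A B C D Ω) := by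
  ext v
  simp [phiW, g2Form, adaptedCoframe, scaledCoframe, wedge_apply, Matrix.det_fin_three]
  ring

/-- The metric determined by `φ_W` has orthonormal coframe `Ae¹, Be², Ce³, De⁴, Ae⁵, Be⁶, Ce⁷`. -/
theorem coframeInner_adaptedCoframe (k l : ℤ) (A B C D : ℝ) (Ω : Fin 3 → Fin 3 → V →L[ℝ] ℂ)
    (u v : V) : coframeInner (adaptedCoframe k l A B C D Ω) u v =
      coframeInner (scaledCoframe k l A B C D Ω) u v := by
  simp [coframeInner, adaptedCoframe, Fin.sum_univ_succ]
  ring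

end Forms

/-! ### Local coordinates on `W_{k,l}` -/

/-- The pull-back of the Maurer–Cartan form by `ψ : E → SU(3)`. -/
def pullMC {E : Type*} [NormedAddCommGroup E] [NormedSpace ℝ E] (ψ : E → SU3) (x : E) :
    Fin 3 → Fin 3 → E →L[ℝ] ℂ :=
  maurerCartan (ψ x) fun i j => fderiv ℝ (fun y => (ψ y : Matrix (Fin 3) (Fin 3) ℂ) i j) x

/-- `x ↦ [ψ x]`, `x ∈ U`, is a local parametrisation of `W_{k,l}` (the inverse of a coordinate
chart), given by a smooth local lift `ψ` to `SU(3)`. Locally every smooth map to `W_{k,l}` has such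
a lift. The vectors of `𝔰𝔲(3)` on which `e¹, …, e⁷` all vanish are those tangent to the circle, so
the third condition says that the differential of `x ↦ [ψ x]` is injective, hence bijective; with
the injectivity condition, the map is a diffeomorphism from `U` onto an open subset of `W_{k,l}`. -/
structure IsChart (k l : ℤ) (ψ : E7 → SU3) (U : Set E7) : Prop where
  isOpen : IsOpen U
  smooth : ∀ i j, ContDiffOn ℝ ∞ (fun x => (ψ x : Matrix (Fin 3) (Fin 3) ℂ) i j) U
  immersive : ∀ x ∈ U, ∀ v : E7, (∀ a, coframe k l (pullMC ψ x) a v = 0) → v = 0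
  injOn : Set.InjOn (fun x => (ψ x : W k l)) U

/-- `φ_W` in the coordinates `ψ`. -/
def phiChart (k l : ℤ) (A B C D : ℝ) (ψ : E7 → SU3) (x : E7) : E7 [⋀^Fin 3]→L[ℝ] ℝ :=
  phiW k l A B C D (pullMC ψ x)

/-- The Riemannian metric determined by `φ_W` in the coordinates `ψ`. -/
def metricChart (k l : ℤ) (A B C D : ℝ) (ψ : E7 → SU3) (x u v : E7) : ℝ :=
  coframeInner (adaptedCoframe k l A B C D (pullMC ψ x)) u v

/-- The `G₂`-structure `φ_W` on `W_{k,l}` is nearly parallel: there is a constant `τ₀ ≠ 0` with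
`dφ_W = τ₀ ⋆φ_W`, in all local coordinates. -/
def IsNearlyParallel (k l : ℤ) (A B C D : ℝ) : Prop :=
  ∃ τ : ℝ, τ ≠ 0 ∧ ∀ (ψ : E7 → SU3) (U : Set E7), IsChart k l ψ U → ∀ x ∈ U,
    ∀ E : Fin 7 → E7,
      (∀ i j, adaptedCoframe k l A B C D (pullMC ψ x) i (E j) = if i = j then 1 else 0) →
      ∀ v : Fin 4 → E7, extDeriv (phiChart k l A B C D ψ) x v =
        τ * hodgeStar (adaptedCoframe k l A B C D (pullMC ψ x)) E (phiChart k l A B C D ψ x) v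

/-! ### Submanifolds -/

/-- `Y` is an embedded 3-dimensional submanifold of `W_{k,l}`: near each of its points there are
coordinates in which it is the slice `ℝ³ × 0 ⊂ ℝ⁷`. -/
def IsEmbeddedThreefold (k l : ℤ) (Y : Set (W k l)) : Prop :=
  ∀ y ∈ Y, ∃ (ψ : E7 → SU3) (U : Set E7) (x : E7), IsChart k l ψ U ∧ x ∈ U ∧
    (ψ x : W k l) = y ∧
    ∀ z ∈ U, ((ψ z : W k l) ∈ Y ↔ z 3 = 0 ∧ z 4 = 0 ∧ z 5 = 0 ∧ z 6 = 0)

/-- In the coordinates `ψ` on `U`, `u : O → U` is a smooth map from an open set `O ⊂ ℝ³` into `Y`;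
where `du` is injective, it is a local parametrisation of the 3-dimensional submanifold `Y`. -/
structure IsParam (k l : ℤ) (Y : Set (W k l)) (ψ : E7 → SU3) (U : Set E7)
    (u : E3 → E7) (O : Set E3) : Prop where
  isChart : IsChart k l ψ U
  isOpen : IsOpen O
  smooth : ContDiffOn ℝ ∞ u O
  mapsTo : Set.MapsTo u O U
  mem : ∀ b ∈ O, (ψ (u b) : W k l) ∈ Y

/-- The vectors `du(t₀), du(t₁), du(t₂)` at `u b` are orthonormal for the inner product `g`
(so they are an orthonormal basis of the tangent space of the parametrised 3-fold). -/
def IsTangentFrame (g : E7 → E7 → ℝ) (u : E3 → E7) (b : E3) (t : Fin 3 → E3) : Prop :=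
  ∀ i j, g (fderiv ℝ u b (t i)) (fderiv ℝ u b (t j)) = if i = j then 1 else 0

/-- `φ_W` restricts to the volume form of `Y` for the orientation of `Y` it defines: it takes the
value `±1` on orthonormal bases of the tangent spaces of `Y`. -/
def IsAssociative (k l : ℤ) (A B C D : ℝ) (Y : Set (W k l)) : Prop :=
  ∀ (ψ : E7 → SU3) (U : Set E7) (u : E3 → E7) (O : Set E3), IsParam k l Y ψ U u O →
    ∀ b ∈ O, ∀ t : Fin 3 → E3, IsTangentFrame (metricChart k l A B C D ψ (u b)) u b t →
      |phiChart k l A B C D ψ (u b) (fun i => fderiv ℝ u b (t i))| = 1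

/-- The Christoffel symbols of the first kind of a metric `g` on an open subset of `ℝ⁷`:
`g(∇ᵤv, w) = ½ (∂ᵤ g(v, w) + ∂ᵥ g(u, w) - ∂_w g(u, v))` for constant `u, v, w`. -/
def christoffel (g : E7 → E7 → E7 → ℝ) (x u v w : E7) : ℝ :=
  (1 / 2) * (fderiv ℝ (fun y => g y v w) x u + fderiv ℝ (fun y => g y u w) x v
    - fderiv ℝ (fun y => g y u v) x w)

/-- `Y` is minimal for the metric determined by `φ_W`: its mean curvature vector, the trace of the
second fundamental form `II(t, t) = (∂ₜ∂ₜ u + Γ(∂ₜu, ∂ₜu))^⊥` over an orthonormal basis of the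
tangent space, vanishes, i.e. is orthogonal to every normal vector `n`. -/
def IsMinimal (k l : ℤ) (A B C D : ℝ) (Y : Set (W k l)) : Prop :=
  ∀ (ψ : E7 → SU3) (U : Set E7) (u : E3 → E7) (O : Set E3), IsParam k l Y ψ U u O →
    ∀ b ∈ O, ∀ t : Fin 3 → E3, IsTangentFrame (metricChart k l A B C D ψ (u b)) u b t →
      ∀ n : E7, (∀ i, metricChart k l A B C D ψ (u b) n (fderiv ℝ u b (t i)) = 0) →
        ∑ i, (metricChart k l A B C D ψ (u b) (fderiv ℝ (fderiv ℝ u) b (t i) (t i)) n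
          + christoffel (metricChart k l A B C D ψ) (u b)
              (fderiv ℝ u b (t i)) (fderiv ℝ u b (t i)) n) = 0

/-! ### Families of spherical space forms -/

/-- `x, y ∈ S³ ⊂ ℂ²` are in the same orbit of the group `ℤ_p` of `p`-th roots of unity, acting
(freely and isometrically) by scalar multiplication. The orbit space is `S³/ℤ_p`. -/
def SameOrbit (p : ℕ) (x y : S3) : Prop :=
  ∃ ζ : ℂ, ζ ^ p = 1 ∧
    (⟨y.1 0, y.1 1⟩ : ℂ) = ζ * ⟨x.1 0, x.1 1⟩ ∧ (⟨y.1 2, y.1 3⟩ : ℂ) = ζ * ⟨x.1 2, x.1 3⟩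

/-- `b ↦ [w b]`, `b ∈ O ⊂ ℝ⁴`, is a local parametrisation of `ℂP²`, with values the points `q b`:
it is smooth and injective, with injective differential (modulo the complex line `[w b]`). -/
structure IsCP2Chart (w : E4 → Fin 3 → ℂ) (q : E4 → CP2) (O : Set E4) : Prop where
  isOpen : IsOpen O
  smooth : ContDiffOn ℝ ∞ w O
  eq_mk : ∀ b ∈ O, ∃ h : w b ≠ 0, q b = Projectivization.mk ℂ (w b) h
  immersive : ∀ b ∈ O, ∀ v : E4, (∃ c : ℂ, fderiv ℝ w b v = c • w b) → v = 0
  injOn : Set.InjOn q O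

/-- The pull-back of the Maurer–Cartan form by `F : ℝ⁴ × S³ → SU(3)`. -/
def pullMCProd (F : E4 × S3 → SU3) (z : E4 × S3) :
    Fin 3 → Fin 3 → TangentSpace ((𝓘(ℝ, E4)).prod (𝓡 3)) z →L[ℝ] ℂ :=
  maurerCartan (F z) fun i j => mfderiv ((𝓘(ℝ, E4)).prod (𝓡 3)) 𝓘(ℝ, ℂ)
    (fun y => (F y : Matrix (Fin 3) (Fin 3) ℂ) i j) z

/-- The sets `Y x`, `x ∈ ℂP²`, are a smooth family of pairwise disjoint submanifolds of `W_{k,l}`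
diffeomorphic to `S³/ℤ_p`, parametrised by the 4-dimensional manifold `ℂP²`. Near each `x₀` there
are coordinates `b ∈ O ⊂ ℝ⁴` on `ℂP²`, and a smooth immersion `[F] : O × S³ → W_{k,l}` between
7-manifolds which induces an injective map on `O × (S³/ℤ_p)` and diffeomorphisms of
`{b} × (S³/ℤ_p)` to `Y (q b)`. (A smooth map of `O × S³` to `W_{k,l}` lifts to a smooth map `F` to
`SU(3)` if `O` is a small ball, since circle bundles over `O × S³` are then trivial.) -/
def IsSpaceFormFamily (k l : ℤ) (p : ℕ) (Y : CP2 → Set (W k l)) : Prop :=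
  (∀ x y : CP2, x ≠ y → Disjoint (Y x) (Y y)) ∧
  ∀ x₀ : CP2, ∃ (w : E4 → Fin 3 → ℂ) (q : E4 → CP2) (O : Set E4) (F : E4 × S3 → SU3),
    IsCP2Chart w q O ∧ x₀ ∈ q '' O ∧
    (∀ i j, ContMDiffOn ((𝓘(ℝ, E4)).prod (𝓡 3)) 𝓘(ℝ, ℂ) ∞
      (fun z => (F z : Matrix (Fin 3) (Fin 3) ℂ) i j) (O ×ˢ Set.univ)) ∧
    (∀ z ∈ O ×ˢ (Set.univ : Set S3), ∀ v : TangentSpace ((𝓘(ℝ, E4)).prod (𝓡 3)) z,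
      (∀ a, coframe k l (pullMCProd F z) a v = 0) → v = 0) ∧
    (∀ b ∈ O, ∀ b' ∈ O, ∀ x x' : S3,
      (F (b, x) : W k l) = (F (b', x') : W k l) ↔ b = b' ∧ SameOrbit p x x') ∧
    ∀ b ∈ O, Set.range (fun x : S3 => (F (b, x) : W k l)) = Y (q b)

end AloffWallach

end

/-!
The fibre of `π_j` through the coset of `a` is `a · SU(2)_j · S¹ / S¹`, where `SU(2)_j` acts on the
two coordinates other than the `j`-th. An element of the circle lies in `SU(2)_j` precisely when its
`j`-th diagonal entry is `1`, so the fibre is `S³` modulo the roots of unity of order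
`|weight k l j|`. Moving `a` along a section of `SU(3) → ℂP²` over an affine chart gives tubes
`ℝ⁴ × S³ → SU(3)` around the fibres, which yield both the embeddings and the smooth family.

The off-diagonal Maurer–Cartan entries in the `j`-th row and column vanish along a fibre of `π_j`,
so only three of the forms `eᵃ` survive there, and `φ_W` restricts to minus the wedge product of the
three scaled forms: the fibre is associative. The second fundamental form in a normal direction `n`
pairs each surviving form `η` with `dη(·, n)`. By the structure equations `n` acts on the two forms
with equal scale by an infinitesimal rotation and annihilates the third, so the trace vanishes.

Since `S³` is simply connected, a homeomorphism between two fibres lifts through the coverings by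
`S³`, and comparing covering fibres shows that the two groups have the same order.
-/

noncomputable section

namespace AloffWallach

/-! ### Complex coordinates on `ℝ⁴` -/

/-- The first complex coordinate on `ℝ⁴ = ℂ²`. -/
def cplxFst : E4 →L[ℝ] ℂ :=
  (Complex.equivRealProdCLM.symm : ℝ × ℝ →L[ℝ] ℂ) ∘L
    (EuclideanSpace.proj (0 : Fin 4)).prod (EuclideanSpace.proj 1)

/-- The second complex coordinate on `ℝ⁴ = ℂ²`. -/
def cplxSnd : E4 →L[ℝ] ℂ :=
  (Complex.equivRealProdCLM.symm : ℝ × ℝ →L[ℝ] ℂ) ∘L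
    (EuclideanSpace.proj (2 : Fin 4)).prod (EuclideanSpace.proj 3)

theorem cplxFst_apply (b : E4) : cplxFst b = ⟨b 0, b 1⟩ := rfl

theorem cplxSnd_apply (b : E4) : cplxSnd b = ⟨b 2, b 3⟩ := rfl

theorem cplx_ext {b b' : E4} (h₁ : cplxFst b = cplxFst b') (h₂ : cplxSnd b = cplxSnd b') :
    b = b' := by
  simp only [cplxFst_apply, cplxSnd_apply, Complex.mk.injEq] at h₁ h₂
  ext i
  fin_cases i
  exacts [h₁.1, h₁.2, h₂.1, h₂.2]

/-- The vector of `ℝ⁴ = ℂ²` with given complex coordinates. -/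
def ofCplx (z₁ z₂ : ℂ) : E4 := !₂[z₁.re, z₁.im, z₂.re, z₂.im]

@[simp] theorem cplxFst_ofCplx (z₁ z₂ : ℂ) : cplxFst (ofCplx z₁ z₂) = z₁ := by
  simp [cplxFst_apply, ofCplx]

@[simp] theorem cplxSnd_ofCplx (z₁ z₂ : ℂ) : cplxSnd (ofCplx z₁ z₂) = z₂ := by
  simp [cplxSnd_apply, ofCplx]

theorem continuous_ofCplx : Continuous fun z : ℂ × ℂ => ofCplx z.1 z.2 := by
  refine (PiLp.continuous_toLp 2 _).comp (continuous_pi fun i => ?_)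
  fin_cases i
  exacts [Complex.continuous_re.comp continuous_fst, Complex.continuous_im.comp continuous_fst,
    Complex.continuous_re.comp continuous_snd, Complex.continuous_im.comp continuous_snd]

theorem cplx_mul_conj_add (b : E4) :
    cplxFst b * conj (cplxFst b) + cplxSnd b * conj (cplxSnd b) = ((‖b‖ ^ 2 : ℝ) : ℂ) := by
  rw [Complex.mul_conj, Complex.mul_conj, EuclideanSpace.norm_sq_eq, ← Complex.ofReal_add]
  congr 1
  simp only [Complex.normSq_mk, cplxFst_apply, cplxSnd_apply, Fin.sum_univ_four,
    Real.norm_eq_abs, sq_abs]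
  ring

theorem inner_eq_re_cplx (x y : E4) : inner ℝ x y =
    (conj (cplxFst x) * cplxFst y + conj (cplxSnd x) * cplxSnd y).re := by
  simp only [cplxFst_apply, cplxSnd_apply, PiLp.inner_apply, Fin.sum_univ_four, RCLike.inner_apply,
    Real.ringHom_apply, Complex.add_re, Complex.mul_re, Complex.conj_re, Complex.conj_im]
  ring

/-- Multiplication by a complex scalar on `ℝ⁴ = ℂ²`. -/
def cmul (ζ : ℂ) (x : E4) : E4 := ofCplx (ζ * cplxFst x) (ζ * cplxSnd x)

@[simp] theorem cplxFst_cmul (ζ : ℂ) (x : E4) : cplxFst (cmul ζ x) = ζ * cplxFst x :=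
  cplxFst_ofCplx _ _

@[simp] theorem cplxSnd_cmul (ζ : ℂ) (x : E4) : cplxSnd (cmul ζ x) = ζ * cplxSnd x :=
  cplxSnd_ofCplx _ _

theorem one_cmul (x : E4) : cmul 1 x = x := cplx_ext (by simp) (by simp)

theorem mul_cmul (ζ ξ : ℂ) (x : E4) : cmul (ζ * ξ) x = cmul ζ (cmul ξ x) :=
  cplx_ext (by simp [mul_assoc]) (by simp [mul_assoc])

theorem norm_cmul (ζ : ℂ) (x : E4) : ‖cmul ζ x‖ = ‖ζ‖ * ‖x‖ := by
  have h : ((‖cmul ζ x‖ ^ 2 : ℝ) : ℂ) = (((‖ζ‖ * ‖x‖) ^ 2 : ℝ) : ℂ) := by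
    rw [← cplx_mul_conj_add, mul_pow, Complex.ofReal_mul (‖ζ‖ ^ 2), ← cplx_mul_conj_add x,
      Complex.ofReal_pow, ← Complex.mul_conj']
    simp only [cplxFst_cmul, cplxSnd_cmul, map_mul]
    ring
  exact (sq_eq_sq₀ (norm_nonneg _) (by positivity)).1 (Complex.ofReal_injective h)

theorem norm_cmul_sub_self (ζ : ℂ) (x : E4) : ‖cmul ζ x - x‖ = ‖ζ - 1‖ * ‖x‖ := by
  rw [← norm_cmul]
  congr 1
  exact cplx_ext (by simp [sub_mul]) (by simp [sub_mul])

theorem continuous_cmul (ζ : ℂ) : Continuous (cmul ζ) :=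
  continuous_ofCplx.comp ((cplxFst.continuous.const_mul ζ).prodMk (cplxSnd.continuous.const_mul ζ))

theorem sameOrbit_iff_exists_cmul {p : ℕ} {x y : S3} :
    SameOrbit p x y ↔ ∃ ζ : ℂ, ζ ^ p = 1 ∧ y.1 = cmul ζ x.1 := by
  refine exists_congr fun ζ => and_congr_right fun _ => ⟨fun h => ?_, fun h => ?_⟩
  · exact cplx_ext (h.1.trans (cplxFst_cmul ζ x.1).symm) (h.2.trans (cplxSnd_cmul ζ x.1).symm)
  · rw [h]
    exact ⟨cplxFst_cmul ζ x.1, cplxSnd_cmul ζ x.1⟩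

/-! ### Special unitary matrices -/

theorem star_coe_mul_coe (g : SU3) :
    star (g : Matrix (Fin 3) (Fin 3) ℂ) * (g : Matrix (Fin 3) (Fin 3) ℂ) = 1 :=
  Matrix.mem_unitaryGroup_iff'.1 (Matrix.mem_specialUnitaryGroup_iff.1 g.2).1

theorem coe_mul_star_coe (g : SU3) :
    (g : Matrix (Fin 3) (Fin 3) ℂ) * star (g : Matrix (Fin 3) (Fin 3) ℂ) = 1 :=
  Matrix.mem_unitaryGroup_iff.1 (Matrix.mem_specialUnitaryGroup_iff.1 g.2).1

theorem mem_specialUnitaryGroup_iff' {n : Type*} [Fintype n] [DecidableEq n] {M : Matrix n n ℂ} :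
    M ∈ Matrix.specialUnitaryGroup n ℂ ↔ star M * M = 1 ∧ M.det = 1 := by
  rw [Matrix.mem_specialUnitaryGroup_iff, Matrix.mem_unitaryGroup_iff']

theorem star_mul_apply {n : Type*} [Fintype n] (M N : Matrix n n ℂ) (i i' : n) :
    (star M * N) i i' = ∑ r, conj (M r i) * N r i' := by
  simp [Matrix.mul_apply, Matrix.star_apply]

/-! ### A section of `SU(3) → ℂP²` over an affine chart -/

/-- The special unitary matrix with last column `(u₁, u₂, c)`, for a unit vector with `c > 0`: the
rotation from the last basis vector to it in the plane they span. -/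
def frameMatrix (u₁ u₂ c : ℂ) : Matrix (Fin 3) (Fin 3) ℂ :=
  !![1 - u₁ * conj u₁ * (1 + c)⁻¹, -(u₁ * conj u₂ * (1 + c)⁻¹), u₁;
    -(u₂ * conj u₁ * (1 + c)⁻¹), 1 - u₂ * conj u₂ * (1 + c)⁻¹, u₂;
    -conj u₁, -conj u₂, c]

theorem frameMatrix_mem {u₁ u₂ : ℂ} {c : ℝ} (hc : 0 < c)
    (h : u₁ * conj u₁ + u₂ * conj u₂ + c ^ 2 = 1) :
    frameMatrix u₁ u₂ c ∈ Matrix.specialUnitaryGroup (Fin 3) ℂ := by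
  have hc' : (1 + c : ℂ) ≠ 0 := mod_cast (by positivity : (1 + c : ℝ) ≠ 0)
  have hconj : conj ((1 + c : ℂ)⁻¹) = (1 + c : ℂ)⁻¹ := by simp
  have hinv : (1 + c : ℂ)⁻¹ * (1 + c) = 1 := inv_mul_cancel₀ hc'
  generalize hd : (1 + c : ℂ)⁻¹ = d at *
  rw [mem_specialUnitaryGroup_iff']
  constructor
  · ext i j
    fin_cases i <;> fin_cases j <;>
      simp [frameMatrix, Matrix.mul_apply, Fin.sum_univ_three, Matrix.star_apply, hd, hconj] <;>
      grind
  · simp only [frameMatrix, hd, Matrix.det_fin_three, Matrix.of_apply, Matrix.cons_val]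
    grind

/-- The factor `1/√(1 + |b|²)` normalising the vector `(z₁, z₂, 1)`. -/
def invNorm (b : E4) : ℝ := (√(1 + ‖b‖ ^ 2))⁻¹

theorem invNorm_pos (b : E4) : 0 < invNorm b := by unfold invNorm; positivity

theorem invNorm_sq_mul (b : E4) : invNorm b ^ 2 * (1 + ‖b‖ ^ 2) = 1 := by
  rw [invNorm, inv_pow, Real.sq_sqrt (by positivity)]
  exact inv_mul_cancel₀ (by positivity)

theorem contDiff_invNorm : ContDiff ℝ ∞ invNorm :=
  ((contDiff_const.add (contDiff_norm_sq ℝ)).sqrt fun b => by positivity).inv fun b => by positivity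

/-- The affine chart `b ↦ (z₁, z₂, 1)` of `ℂP²`. -/
def affineVec (b : E4) : Fin 3 → ℂ := ![cplxFst b, cplxSnd b, 1]

theorem affineVec_injective : Function.Injective affineVec := fun _ _ h =>
  cplx_ext (congrFun h 0) (congrFun h 1)

/-- The matrix in `SU(3)` whose last column is the normalisation of `affineVec b`. -/
def affineFrame (b : E4) : SU3 :=
  ⟨frameMatrix (invNorm b * cplxFst b) (invNorm b * cplxSnd b) (invNorm b : ℝ), by
    refine frameMatrix_mem (invNorm_pos b) ?_
    have h : ((invNorm b : ℝ) : ℂ) ^ 2 * (1 + ((‖b‖ ^ 2 : ℝ) : ℂ)) = 1 :=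
      mod_cast invNorm_sq_mul b
    rw [← cplx_mul_conj_add b] at h
    simp only [map_mul, Complex.conj_ofReal]
    linear_combination h⟩

theorem affineFrame_apply_two (b : E4) (i : Fin 3) :
    (affineFrame b : Matrix (Fin 3) (Fin 3) ℂ) i 2 = invNorm b * affineVec b i := by
  fin_cases i <;> simp [affineFrame, frameMatrix, affineVec]

theorem affineFrame_zero : affineFrame 0 = 1 := by
  ext i j
  fin_cases i <;> fin_cases j <;> simp [affineFrame, frameMatrix, invNorm]

theorem contDiff_affineFrame (i j : Fin 3) :
    ContDiff ℝ ∞ fun b => (affineFrame b : Matrix (Fin 3) (Fin 3) ℂ) i j := by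
  have hconj : ContDiff ℝ ∞ fun z : ℂ => conj z := Complex.conjCLE.contDiff
  have hc : ContDiff ℝ ∞ fun b => ((invNorm b : ℝ) : ℂ) :=
    Complex.ofRealCLM.contDiff.comp contDiff_invNorm
  have hinv : ContDiff ℝ ∞ fun b => (1 + ((invNorm b : ℝ) : ℂ))⁻¹ := by
    refine (contDiff_const.add hc).inv fun b => ?_
    have := invNorm_pos b
    exact_mod_cast (by positivity : (1 + invNorm b : ℝ) ≠ 0)
  have h₁ := hc.mul cplxFst.contDiff
  have h₂ := hc.mul cplxSnd.contDiff
  fin_cases i <;> fin_cases j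
  exacts [contDiff_const.sub ((h₁.mul (hconj.comp h₁)).mul hinv),
    ((h₁.mul (hconj.comp h₂)).mul hinv).neg, h₁, ((h₂.mul (hconj.comp h₁)).mul hinv).neg,
    contDiff_const.sub ((h₂.mul (hconj.comp h₂)).mul hinv), h₂, (hconj.comp h₁).neg,
    (hconj.comp h₂).neg, hc]

/-! ### The block subgroup `SU(2)` -/

/-- The matrix of the quaternion with complex coordinates `y`, acting on the first two coordinates
of `ℂ³` and killing the third. -/
def quatMatrix : E4 →ₗ[ℝ] Matrix (Fin 3) (Fin 3) ℂ where
  toFun y := !![cplxFst y, -conj (cplxSnd y), 0; cplxSnd y, conj (cplxFst y), 0; 0, 0, 0]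
  map_add' y η := by
    ext i j
    fin_cases i <;> fin_cases j <;> simp [add_comm]
  map_smul' t y := by
    ext i j
    fin_cases i <;> fin_cases j <;> simp

theorem quatMatrix_apply (y : E4) : quatMatrix y =
    !![cplxFst y, -conj (cplxSnd y), 0; cplxSnd y, conj (cplxFst y), 0; 0, 0, 0] := rfl

/-- The quaternion `y` as a matrix acting on the first two coordinates of `ℂ³`, and trivially on
the third. For `‖y‖ = 1` these are the elements of the block subgroup `SU(2)` of `SU(3)`. -/
def blockMatrix (y : E4) : Matrix (Fin 3) (Fin 3) ℂ := quatMatrix y + Matrix.single 2 2 1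

theorem blockMatrix_eq (y : E4) : blockMatrix y =
    !![cplxFst y, -conj (cplxSnd y), 0; cplxSnd y, conj (cplxFst y), 0; 0, 0, 1] := by
  ext i j
  fin_cases i <;> fin_cases j <;> simp [blockMatrix, quatMatrix_apply, Matrix.single]

theorem contDiff_blockMatrix (i j : Fin 3) : ContDiff ℝ ∞ fun y => blockMatrix y i j := by
  have hconj : ContDiff ℝ ∞ fun z : ℂ => conj z := Complex.conjCLE.contDiff
  simp only [blockMatrix_eq]
  fin_cases i <;> fin_cases j
  exacts [cplxFst.contDiff, (hconj.comp cplxSnd.contDiff).neg, contDiff_const, cplxSnd.contDiff,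
    hconj.comp cplxFst.contDiff, contDiff_const, contDiff_const, contDiff_const, contDiff_const]

theorem star_blockMatrix_mul (y : E4) : star (blockMatrix y) * blockMatrix y =
    Matrix.diagonal ![((‖y‖ ^ 2 : ℝ) : ℂ), ((‖y‖ ^ 2 : ℝ) : ℂ), 1] := by
  rw [← cplx_mul_conj_add, blockMatrix_eq]
  ext i j
  fin_cases i <;> fin_cases j <;>
    simp [Matrix.mul_apply, Fin.sum_univ_three, Matrix.star_apply] <;> ring

theorem star_blockMatrix_mul_quatMatrix (x η : E4) : star (blockMatrix x) * quatMatrix η =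
    quatMatrix (ofCplx (conj (cplxFst x) * cplxFst η + conj (cplxSnd x) * cplxSnd η)
      (cplxFst x * cplxSnd η - cplxSnd x * cplxFst η)) := by
  ext i j
  fin_cases i <;> fin_cases j <;>
    simp [blockMatrix_eq, quatMatrix_apply, Matrix.mul_apply, Fin.sum_univ_three,
      Matrix.star_apply] <;> ring

theorem blockMatrix_mem {y : E4} (hy : ‖y‖ = 1) :
    blockMatrix y ∈ Matrix.specialUnitaryGroup (Fin 3) ℂ := by
  rw [mem_specialUnitaryGroup_iff']
  constructor
  · rw [star_blockMatrix_mul, hy]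
    ext i j
    fin_cases i <;> fin_cases j <;> simp
  · have h := cplx_mul_conj_add y
    rw [hy, one_pow, Complex.ofReal_one] at h
    rw [blockMatrix_eq, Matrix.det_fin_three]
    simp only [Matrix.of_apply, Matrix.cons_val]
    linear_combination h

theorem eq_zero_of_star_blockMatrix_mul_quatMatrix {x η : E4} (hx : ‖x‖ = 1)
    (h : star (blockMatrix x) * quatMatrix η = 0) : η = 0 := by
  have hmem := (Matrix.mem_unitaryGroup_iff.1
    (Matrix.mem_specialUnitaryGroup_iff.1 (blockMatrix_mem hx)).1)
  have h0 : quatMatrix η = 0 := by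
    rw [← one_mul (quatMatrix η), ← hmem, mul_assoc, h, mul_zero]
  rw [quatMatrix_apply] at h0
  exact cplx_ext (by simpa using congrFun (congrFun h0 0) 0)
    (by simpa using congrFun (congrFun h0 1) 0)

/-! ### Matrix-valued maps and the Maurer–Cartan form -/

section EntryDeriv

variable {X : Type*} [NormedAddCommGroup X] [NormedSpace ℝ X] {n : Type*}
  {F G : X → Matrix n n ℂ} {x : X}

/-- The directional derivative at `x` of a matrix-valued map, taken entry by entry (matrices carry
no preferred norm). -/
def entryDeriv (F : X → Matrix n n ℂ) (x ξ : X) : Matrix n n ℂ :=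
  Matrix.of fun i j => fderiv ℝ (fun y => F y i j) x ξ

theorem entryDeriv_apply (F : X → Matrix n n ℂ) (x ξ : X) (i j : n) :
    entryDeriv F x ξ i j = fderiv ℝ (fun y => F y i j) x ξ := rfl

theorem entryDeriv_zero (F : X → Matrix n n ℂ) (x : X) : entryDeriv F x 0 = 0 := by
  ext i j
  simp [entryDeriv_apply]

theorem entryDeriv_const (M : Matrix n n ℂ) (x ξ : X) : entryDeriv (fun _ => M) x ξ = 0 := by
  ext i j
  simp [entryDeriv_apply]

theorem entryDeriv_star (hF : ∀ i j, DifferentiableAt ℝ (fun y => F y i j) x) (ξ : X) :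
    entryDeriv (fun y => star (F y)) x ξ = star (entryDeriv F x ξ) := by
  ext i j
  have h := (Complex.conjCLE : ℂ →L[ℝ] ℂ).hasFDerivAt.comp x (hF j i).hasFDerivAt
  exact congrArg (fun L => L ξ) h.fderiv

theorem entryDeriv_mul [Fintype n] (hF : ∀ i j, DifferentiableAt ℝ (fun y => F y i j) x)
    (hG : ∀ i j, DifferentiableAt ℝ (fun y => G y i j) x) (ξ : X) :
    entryDeriv (fun y => F y * G y) x ξ = entryDeriv F x ξ * G x + F x * entryDeriv G x ξ := by
  ext i j
  have h := HasFDerivAt.fun_sum (u := Finset.univ) fun r _ =>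
    (hF i r).hasFDerivAt.fun_mul (hG r j).hasFDerivAt
  simp only [entryDeriv_apply, Matrix.add_apply, Matrix.mul_apply, ← Finset.sum_add_distrib]
  rw [h.fderiv]
  simp only [sum_apply, add_apply, smul_apply, smul_eq_mul]
  exact Finset.sum_congr rfl fun r _ => by ring

theorem entryDeriv_comp {Y : Type*} [NormedAddCommGroup Y] [NormedSpace ℝ Y] {f : Y → X} {y : Y}
    (hF : ∀ i j, DifferentiableAt ℝ (fun y => F y i j) (f y)) (hf : DifferentiableAt ℝ f y)
    (ξ : Y) : entryDeriv (fun y => F (f y)) y ξ = entryDeriv F (f y) (fderiv ℝ f y ξ) := by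
  ext i j
  exact congrArg (fun L => L ξ) (fderiv_comp y (hF i j) hf)

/-- Differentiate `F* F = 1`. -/
theorem star_mul_entryDeriv_skew {F : X → SU3}
    (hF : ∀ i j, DifferentiableAt ℝ (fun y => (F y : Matrix (Fin 3) (Fin 3) ℂ) i j) x) (ξ : X) :
    star (star (F x : Matrix (Fin 3) (Fin 3) ℂ) *
        entryDeriv (fun y => (F y : Matrix (Fin 3) (Fin 3) ℂ)) x ξ) =
      -(star (F x : Matrix (Fin 3) (Fin 3) ℂ) *
        entryDeriv (fun y => (F y : Matrix (Fin 3) (Fin 3) ℂ)) x ξ) := by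
  have hconst : (fun y => star (F y : Matrix (Fin 3) (Fin 3) ℂ) * F y) = fun _ => 1 :=
    funext fun y => star_coe_mul_coe (F y)
  have hstar : ∀ i j, DifferentiableAt ℝ
      (fun y => star (F y : Matrix (Fin 3) (Fin 3) ℂ) i j) x := fun i j =>
    (Complex.conjCLE : ℂ →L[ℝ] ℂ).differentiableAt.comp x (hF j i)
  have h := entryDeriv_mul hstar hF ξ
  rw [hconst, entryDeriv_const, entryDeriv_star hF] at h
  rw [star_mul, star_star]
  exact eq_neg_of_add_eq_zero_left h.symm

end EntryDeriv

section Coframe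

variable {V : Type*} [AddCommGroup V] [Module ℝ V] [TopologicalSpace V]

theorem maurerCartan_apply (g : SU3) (dg : Fin 3 → Fin 3 → V →L[ℝ] ℂ) (i j : Fin 3) (v : V) :
    maurerCartan g dg i j v =
      (star (g : Matrix (Fin 3) (Fin 3) ℂ) * Matrix.of fun r s => dg r s v) i j := by
  simp [maurerCartan, star_mul_apply]

theorem coframe_cyclic_eq_zero {k l : ℤ} {Ω : Fin 3 → Fin 3 → V →L[ℝ] ℂ} {v : V}
    (h : ∀ a, coframe k l Ω a v = 0) (i : Fin 3) : Ω i (i + 1) v = 0 := by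
  have h2 : √2 ≠ 0 := by positivity
  have hre : (Ω i (i + 1) v).re = 0 := by
    have := h (![0, 1, 2] i)
    fin_cases i <;> simpa [coframe, h2] using this
  have him : (Ω i (i + 1) v).im = 0 := by
    have := h (![4, 5, 6] i)
    fin_cases i <;> simpa [coframe, h2] using this
  exact Complex.ext hre him

theorem sNorm_pos {k l : ℤ} {j : Fin 3} (hw : weight k l j ≠ 0) : 0 < sNorm k l := by
  refine Real.sqrt_pos.2 (div_pos (Finset.sum_pos' (fun i _ => sq_nonneg _)
    ⟨j, Finset.mem_univ _, ?_⟩) (by norm_num))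
  have : (weight k l j : ℝ) ≠ 0 := mod_cast hw
  positivity

theorem sum_coweight_mul_im_eq_zero {k l : ℤ} {j : Fin 3} (hw : weight k l j ≠ 0)
    {Ω : Fin 3 → Fin 3 → V →L[ℝ] ℂ} {v : V} (h : coframe k l Ω 3 v = 0) :
    ∑ i, (coweight k l i : ℝ) * (Ω i i v).im = 0 := by
  have hs := (sNorm_pos hw).ne'
  have h2 : √2 ≠ 0 := by positivity
  simpa [coframe, h2, hs] using h

end Coframe

theorem coweight_add_one_sub_add_two (k l : ℤ) (j : Fin 3) :
    coweight k l (j + 1) - coweight k l (j + 2) = -3 * weight k l j := by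
  fin_cases j <;> simp [coweight, weight] <;> ring

theorem sum_fin_three_cyclic {M : Type*} [AddCommMonoid M] (f : Fin 3 → M) (j : Fin 3) :
    ∑ i, f i = f j + f (j + 1) + f (j + 2) := by
  rw [← Equiv.sum_comp (Equiv.addLeft j) f, Fin.sum_univ_three]
  simp

/-! ### Cyclic relabelling of the coordinates -/

/-- The cyclic permutation of the indices which takes `j` to `2`. -/
def relabel (j : Fin 3) : Fin 3 ≃ Fin 3 := Equiv.addRight (2 - j)

@[simp] theorem relabel_self (j : Fin 3) : relabel j j = 2 := by simp [relabel]

@[simp] theorem relabel_add_one (j : Fin 3) : relabel j (j + 1) = 0 := by revert j; decide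

@[simp] theorem relabel_add_two (j : Fin 3) : relabel j (j + 2) = 1 := by revert j; decide

/-- Conjugation by the permutation matrix of `relabel j`: the effect on matrices of moving the last
coordinate of `ℂ³` to the `j`-th place. -/
def cyc (j : Fin 3) : Matrix (Fin 3) (Fin 3) ℂ ≃ₐ[ℂ] Matrix (Fin 3) (Fin 3) ℂ :=
  Matrix.reindexAlgEquiv ℂ ℂ (relabel j).symm

theorem cyc_apply (j : Fin 3) (M : Matrix (Fin 3) (Fin 3) ℂ) (i i' : Fin 3) :
    cyc j M i i' = M (relabel j i) (relabel j i') := rfl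

theorem star_cyc (j : Fin 3) (M : Matrix (Fin 3) (Fin 3) ℂ) : star (cyc j M) = cyc j (star M) :=
  rfl

theorem cyc_mem_iff {j : Fin 3} {M : Matrix (Fin 3) (Fin 3) ℂ} :
    cyc j M ∈ Matrix.specialUnitaryGroup (Fin 3) ℂ ↔
      M ∈ Matrix.specialUnitaryGroup (Fin 3) ℂ := by
  rw [mem_specialUnitaryGroup_iff', mem_specialUnitaryGroup_iff', star_cyc, ← map_mul,
    EmbeddingLike.map_eq_one_iff]
  exact and_congr_right fun _ => by rw [cyc, Matrix.det_reindexAlgEquiv]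

theorem entryDeriv_cyc {X : Type*} [NormedAddCommGroup X] [NormedSpace ℝ X] (j : Fin 3)
    (F : X → Matrix (Fin 3) (Fin 3) ℂ) (x ξ : X) :
    entryDeriv (fun y => cyc j (F y)) x ξ = cyc j (entryDeriv F x ξ) := rfl

/-! ### Affine charts of `ℂP²` -/

/-- The linear automorphism of `ℂ³` given by `g`, after moving the last coordinate to the `j`-th
place. -/
def lineMap (g : SU3) (j : Fin 3) : (Fin 3 → ℂ) ≃ₗ[ℂ] (Fin 3 → ℂ) :=
  (LinearEquiv.funCongrLeft ℂ ℂ (relabel j)).trans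
    (Matrix.toLin'OfInv (star_coe_mul_coe g) (coe_mul_star_coe g))

theorem lineMap_apply (g : SU3) (j : Fin 3) (v : Fin 3 → ℂ) :
    lineMap g j v = (g : Matrix (Fin 3) (Fin 3) ℂ).mulVec fun r => v (relabel j r) := rfl

/-- Homogeneous coordinates in an affine chart of `ℂP²` centred at the `j`-th column of `g`. -/
def lineVec (g : SU3) (j : Fin 3) (b : E4) : Fin 3 → ℂ := lineMap g j (affineVec b)

theorem lineVec_ne_zero (g : SU3) (j : Fin 3) (b : E4) : lineVec g j b ≠ 0 := by
  refine (lineMap g j).map_ne_zero_iff.2 fun h => ?_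
  simpa [affineVec] using congrFun h 2

/-- The point of `ℂP²` with homogeneous coordinates `lineVec g j b`. -/
def linePoint (g : SU3) (j : Fin 3) (b : E4) : CP2 :=
  Projectivization.mk ℂ (lineVec g j b) (lineVec_ne_zero g j b)

theorem linePoint_injective (g : SU3) (j : Fin 3) : Function.Injective (linePoint g j) := by
  intro b b' h
  obtain ⟨a, ha⟩ := (Projectivization.mk_eq_mk_iff' ℂ _ _ _ _).1 h
  rw [lineVec, ← map_smul] at ha
  have hab : a • affineVec b' = affineVec b := (lineMap g j).injective ha
  have ha1 : a = 1 := by simpa [affineVec] using congrFun hab 2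
  rw [ha1, one_smul] at hab
  exact (affineVec_injective hab).symm

theorem hasFDerivAt_lineVec (g : SU3) (j : Fin 3) (b : E4) :
    HasFDerivAt (lineVec g j) ((((lineMap g j).toContinuousLinearEquiv :
      (Fin 3 → ℂ) →L[ℂ] (Fin 3 → ℂ)).restrictScalars ℝ) ∘L
        ContinuousLinearMap.pi ![cplxFst, cplxSnd, 0]) b := by
  refine (((lineMap g j).toContinuousLinearEquiv :
    (Fin 3 → ℂ) →L[ℂ] (Fin 3 → ℂ)).restrictScalars ℝ).hasFDerivAt.comp b
      (hasFDerivAt_pi.2 fun i => ?_)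
  fin_cases i
  exacts [cplxFst.hasFDerivAt, cplxSnd.hasFDerivAt, hasFDerivAt_const _ _]

theorem contDiff_lineVec (g : SU3) (j : Fin 3) : ContDiff ℝ ∞ (lineVec g j) := by
  refine (((lineMap g j).toContinuousLinearEquiv :
    (Fin 3 → ℂ) →L[ℂ] (Fin 3 → ℂ)).restrictScalars ℝ).contDiff.comp (contDiff_pi.2 fun i => ?_)
  fin_cases i
  exacts [cplxFst.contDiff, cplxSnd.contDiff, contDiff_const]

theorem eq_zero_of_fderiv_lineVec_eq_smul {g : SU3} {j : Fin 3} {b β : E4} {c : ℂ}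
    (h : fderiv ℝ (lineVec g j) b β = c • lineVec g j b) : β = 0 := by
  rw [(hasFDerivAt_lineVec g j b).fderiv, lineVec, ← map_smul] at h
  have h' : (fun i => (![cplxFst, cplxSnd, 0] : Fin 3 → E4 →L[ℝ] ℂ) i β) = c • affineVec b :=
    (lineMap g j).injective h
  have hc : c = 0 := by simpa [affineVec] using (congrFun h' 2).symm
  rw [hc, zero_smul] at h'
  exact cplx_ext (by simpa using congrFun h' 0) (by simpa using congrFun h' 1)

theorem isCP2Chart_lineVec (g : SU3) (j : Fin 3) :
    IsCP2Chart (lineVec g j) (linePoint g j) Set.univ where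
  isOpen := isOpen_univ
  smooth := (contDiff_lineVec g j).contDiffOn
  eq_mk b _ := ⟨lineVec_ne_zero g j b, rfl⟩
  immersive _ _ _ := fun ⟨_, h⟩ => eq_zero_of_fderiv_lineVec_eq_smul h
  injOn := (linePoint_injective g j).injOn

/-- The derivative of a curve of vectors modulo the span of its value does not change when the curve
is rescaled. -/
theorem exists_fderiv_eq_smul_of_fderiv_smul {𝕜 E F : Type*} [NormedField 𝕜] [NormedAlgebra ℝ 𝕜]
    [NormedAddCommGroup E] [NormedSpace ℝ E] [NormedAddCommGroup F] [NormedSpace ℝ F]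
    [NormedSpace 𝕜 F] [IsScalarTower ℝ 𝕜 F] {f : E → 𝕜} {w : E → F} {b v : E} {c : 𝕜}
    (hf : DifferentiableAt ℝ f b) (hw : DifferentiableAt ℝ w b) (hfb : f b ≠ 0)
    (h : fderiv ℝ (fun y => f y • w y) b v = c • (f b • w b)) :
    ∃ c' : 𝕜, fderiv ℝ w b v = c' • w b := by
  refine ⟨c - (f b)⁻¹ * fderiv ℝ f b v, ?_⟩
  rw [fderiv_fun_smul hf hw] at h
  have h' : f b • fderiv ℝ w b v + fderiv ℝ f b v • w b = c • (f b • w b) := h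
  rw [← smul_right_injective F hfb |>.eq_iff]
  rw [eq_sub_of_add_eq h', smul_smul, smul_smul, ← sub_smul, mul_sub, mul_inv_cancel_left₀ hfb,
    mul_comm c]

/-! ### The tube maps -/

/-- A section of the `j`-th projection `SU(3) → ℂP²` over the chart `lineVec g j`. -/
def tubeBase (g : SU3) (j : Fin 3) (b : E4) : SU3 :=
  g * ⟨cyc j (affineFrame b), cyc_mem_iff.2 (affineFrame b).2⟩

/-- The subgroup `SU(2)` of `SU(3)` fixing the `j`-th basis vector, parametrised by `S³`. -/
def block (j : Fin 3) (x : S3) : SU3 :=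
  ⟨cyc j (blockMatrix x.1), cyc_mem_iff.2 (blockMatrix_mem (by simp))⟩

/-- The map parametrising the fibres of the `j`-th projection near the `j`-th column of `g`. -/
def tube (g : SU3) (j : Fin 3) (z : E4 × S3) : SU3 := tubeBase g j z.1 * block j z.2

/-- The extension of `tube` to the ambient vector space `ℝ⁴ × ℝ⁴`, with values in matrices. -/
def tubeMatrix (g : SU3) (j : Fin 3) (z : E4 × E4) : Matrix (Fin 3) (Fin 3) ℂ :=
  (tubeBase g j z.1 : Matrix (Fin 3) (Fin 3) ℂ) * cyc j (blockMatrix z.2)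

theorem coe_tube (g : SU3) (j : Fin 3) (z : E4 × S3) :
    (tube g j z).1 = tubeMatrix g j (z.1, z.2.1) := rfl

theorem tubeBase_zero (g : SU3) (j : Fin 3) : tubeBase g j 0 = g := by
  ext1
  simp [tubeBase, affineFrame_zero]

theorem tubeBase_apply_self (g : SU3) (j : Fin 3) (b : E4) (i : Fin 3) :
    (tubeBase g j b).1 i j = invNorm b * lineVec g j b i := by
  simp only [tubeBase, Submonoid.coe_mul, Matrix.mul_apply, cyc_apply, relabel_self,
    affineFrame_apply_two, lineVec, lineMap_apply, Matrix.mulVec, dotProduct, Finset.mul_sum]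
  exact Finset.sum_congr rfl fun r _ => by ring

theorem cyc_blockMatrix_apply_self (j : Fin 3) (y : E4) (i : Fin 3) :
    cyc j (blockMatrix y) i j = (1 : Matrix (Fin 3) (Fin 3) ℂ) i j := by
  rw [← map_one (cyc j), cyc_apply, cyc_apply, relabel_self, blockMatrix_eq]
  generalize relabel j i = r
  fin_cases r <;> simp [Matrix.one_apply]

theorem tubeMatrix_apply_self (g : SU3) (j : Fin 3) (z : E4 × E4) (i : Fin 3) :
    tubeMatrix g j z i j = invNorm z.1 * lineVec g j z.1 i := by
  rw [← tubeBase_apply_self, tubeMatrix, Matrix.mul_apply]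
  simp only [cyc_blockMatrix_apply_self]
  rw [← Matrix.mul_apply, mul_one]

theorem contDiff_tubeBase (g : SU3) (j i i' : Fin 3) :
    ContDiff ℝ ∞ fun b => (tubeBase g j b).1 i i' := by
  simp only [tubeBase, Submonoid.coe_mul, Matrix.mul_apply]
  exact ContDiff.sum fun r _ => contDiff_const.mul (contDiff_affineFrame _ _)

theorem contDiff_tubeMatrix (g : SU3) (j i i' : Fin 3) :
    ContDiff ℝ ∞ fun z => tubeMatrix g j z i i' := by
  simp only [tubeMatrix, Matrix.mul_apply]
  exact ContDiff.sum fun r _ => ((contDiff_tubeBase g j i r).comp contDiff_fst).mul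
    ((contDiff_blockMatrix _ _).comp contDiff_snd)

theorem entryDeriv_blockMatrix (x η : E4) : entryDeriv blockMatrix x η = quatMatrix η := by
  ext i i'
  have h (i i' : Fin 3) (y : E4) : blockMatrix y i i' =
      (LinearMap.toContinuousLinearMap (LinearMap.comp
        (LinearMap.restrictScalars ℝ (Matrix.entryLinearMap ℂ ℂ i i')) quatMatrix)) y +
          Matrix.single (2 : Fin 3) (2 : Fin 3) (1 : ℂ) i i' := rfl
  rw [entryDeriv_apply]
  simp only [h]
  rw [fderiv_add_const, ContinuousLinearMap.fderiv]
  rfl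

theorem entryDeriv_tubeMatrix (g : SU3) (j : Fin 3) (b x β η : E4) :
    entryDeriv (tubeMatrix g j) (b, x) (β, η) =
      entryDeriv (fun b => (tubeBase g j b).1) b β *
          cyc j (blockMatrix x) +
        (tubeBase g j b).1 * cyc j (quatMatrix η) := by
  have hbase (i i' : Fin 3) : DifferentiableAt ℝ
      (fun b => (tubeBase g j b).1 i i') b :=
    (contDiff_tubeBase g j i i').differentiable (by simp) b
  have hblock (i i' : Fin 3) : DifferentiableAt ℝ (fun y => cyc j (blockMatrix y) i i') x :=
    (contDiff_blockMatrix _ _).differentiable (by simp) x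
  have h := entryDeriv_mul (F := fun z : E4 × E4 => (tubeBase g j z.1 : Matrix (Fin 3) (Fin 3) ℂ))
    (G := fun z : E4 × E4 => cyc j (blockMatrix z.2)) (x := (b, x))
    (fun i i' => DifferentiableAt.comp (g := fun b => (tubeBase g j b).1 i i') (b, x)
      (hbase i i') differentiableAt_fst)
    (fun i i' => DifferentiableAt.comp (g := fun y => cyc j (blockMatrix y) i i') (b, x)
      (hblock i i') differentiableAt_snd) (β, η)
  have h₁ := entryDeriv_comp (F := fun b => (tubeBase g j b).1) (y := (b, x)) hbase
    differentiableAt_fst (β, η)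
  have h₂ := entryDeriv_comp (F := fun y => cyc j (blockMatrix y)) (y := (b, x)) hblock
    differentiableAt_snd (β, η)
  rw [fderiv_fst] at h₁
  rw [fderiv_snd] at h₂
  rw [h₁, h₂, entryDeriv_cyc, entryDeriv_blockMatrix] at h
  exact h

theorem apply_eq_zero_of_coframe_eq_zero {V : Type*} [AddCommGroup V] [Module ℝ V]
    [TopologicalSpace V] {k l : ℤ} {Ω : Fin 3 → Fin 3 → V →L[ℝ] ℂ} {v : V}
    (hskew : star (Matrix.of fun i i' => Ω i i' v) = -Matrix.of fun i i' => Ω i i' v)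
    (h : ∀ a, coframe k l Ω a v = 0) {i i' : Fin 3} (hne : i ≠ i') : Ω i i' v = 0 := by
  obtain rfl | rfl : i' = i + 1 ∨ i = i' + 1 := by revert i i'; decide
  · exact coframe_cyclic_eq_zero h i
  · have h' : conj (Ω i' (i' + 1) v) = -Ω (i' + 1) i' v :=
      congrFun (congrFun hskew (i' + 1)) i'
    rw [coframe_cyclic_eq_zero h, map_zero] at h'
    exact neg_eq_zero.1 h'.symm

theorem star_tubeMatrix_mul_entryDeriv (g : SU3) (j : Fin 3) (b x β η : E4) :
    star (tubeMatrix g j (b, x)) * entryDeriv (tubeMatrix g j) (b, x) (β, η) =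
      star (cyc j (blockMatrix x)) * (star (tubeBase g j b).1 *
          entryDeriv (fun b => (tubeBase g j b).1) b β) * cyc j (blockMatrix x) +
        cyc j (star (blockMatrix x) * quatMatrix η) := by
  rw [entryDeriv_tubeMatrix, tubeMatrix, star_mul, mul_add, map_mul, star_cyc]
  congr 1
  · simp only [mul_assoc]
  · rw [mul_assoc, ← mul_assoc (star (tubeBase g j b).1), star_coe_mul_coe, one_mul]

theorem star_quatMatrix_of_re_eq_zero {y : E4} (hy : (cplxFst y).re = 0) :
    star (quatMatrix y) = -quatMatrix y := by
  have hconj : conj (cplxFst y) = -cplxFst y := by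
    apply Complex.ext <;> simp [hy]
  ext i i'
  fin_cases i <;> fin_cases i' <;> simp [quatMatrix_apply, Matrix.star_apply, hconj]

/-- `star (blockMatrix x) * quatMatrix η` is the product of quaternions `x̄ η`, whose real part is
the inner product. -/
theorem star_blockMatrix_mul_quatMatrix_skew {x η : E4} (hη : inner ℝ x η = 0) :
    star (star (blockMatrix x) * quatMatrix η) = -(star (blockMatrix x) * quatMatrix η) := by
  rw [inner_eq_re_cplx] at hη
  rw [star_blockMatrix_mul_quatMatrix]
  exact star_quatMatrix_of_re_eq_zero (by rwa [cplxFst_ofCplx])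

theorem star_tubeMatrix_mul_entryDeriv_skew (g : SU3) (j : Fin 3) (b β : E4) {x η : E4}
    (hη : inner ℝ x η = 0) :
    star (star (tubeMatrix g j (b, x)) * entryDeriv (tubeMatrix g j) (b, x) (β, η)) =
      -(star (tubeMatrix g j (b, x)) * entryDeriv (tubeMatrix g j) (b, x) (β, η)) := by
  have hbase := star_mul_entryDeriv_skew (F := tubeBase g j) (x := b)
    (fun i i' => (contDiff_tubeBase g j i i').differentiable (by simp) b) β
  rw [star_tubeMatrix_mul_entryDeriv, star_add, star_mul, star_mul, hbase, star_star, star_cyc,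
    star_cyc, star_blockMatrix_mul_quatMatrix_skew hη, map_neg, neg_mul, mul_neg, neg_add,
    ← mul_assoc]

theorem differentiableAt_invNorm (b : E4) :
    DifferentiableAt ℝ (fun b => ((invNorm b : ℝ) : ℂ)) b :=
  Complex.ofRealCLM.differentiableAt.comp b (contDiff_invNorm.differentiable (by simp) b)

theorem entryDeriv_tubeMatrix_apply_self (g : SU3) (j : Fin 3) (b x β η : E4) (i : Fin 3) :
    entryDeriv (tubeMatrix g j) (b, x) (β, η) i j =
      fderiv ℝ (fun y => ((invNorm y : ℝ) : ℂ) • lineVec g j y) b β i := by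
  have h := hasFDerivAt_pi'.1 ((differentiableAt_invNorm b).smul
    (hasFDerivAt_lineVec g j b).differentiableAt).hasFDerivAt i
  have hfst := (HasFDerivAt.comp (f := Prod.fst) (b, x) h hasFDerivAt_fst).fderiv
  simp only [entryDeriv_apply, tubeMatrix_apply_self]
  exact congrArg (fun L => L (β, η)) hfst

/-- The `j`-th column of the tube map is the point of `ℂP²`, so it moves along with `b`. -/
theorem eq_zero_of_entryDeriv_tubeMatrix {g : SU3} {j : Fin 3} {b x β η : E4} (hx : ‖x‖ = 1)
    (h : ∀ i ≠ j,
      (star (tubeMatrix g j (b, x)) * entryDeriv (tubeMatrix g j) (b, x) (β, η)) i j = 0) :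
    β = 0 := by
  set M := star (tubeMatrix g j (b, x)) * entryDeriv (tubeMatrix g j) (b, x) (β, η) with hM
  have hmul : entryDeriv (tubeMatrix g j) (b, x) (β, η) = tubeMatrix g j (b, x) * M := by
    rw [hM, ← mul_assoc, ← coe_tube g j (b, ⟨x, by simpa using hx⟩), coe_mul_star_coe, one_mul]
  have hcol : fderiv ℝ (fun y => ((invNorm y : ℝ) : ℂ) • lineVec g j y) b β =
      M j j • (((invNorm b : ℝ) : ℂ) • lineVec g j b) := by
    ext i
    rw [← entryDeriv_tubeMatrix_apply_self g j b x β η, hmul, Matrix.mul_apply,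
      Finset.sum_eq_single j (fun r _ hr => by rw [h r hr, mul_zero]) (by simp),
      tubeMatrix_apply_self]
    exact mul_comm _ _
  obtain ⟨c, hc⟩ := exists_fderiv_eq_smul_of_fderiv_smul (differentiableAt_invNorm b)
    (hasFDerivAt_lineVec g j b).differentiableAt
    (Complex.ofReal_ne_zero.2 (invNorm_pos b).ne') hcol
  exact eq_zero_of_fderiv_lineVec_eq_smul hc

/-- An element of the Lie algebra of the block subgroup on which all of the `eᵃ` vanish is a
multiple of `diag(i, -i, 0)`, and the coefficient vanishes because `e⁴` does. -/
theorem eq_zero_of_coframe_cyc_quatMatrix {V : Type*} [AddCommGroup V] [Module ℝ V]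
    [TopologicalSpace V] {k l : ℤ} {j : Fin 3} (hw : weight k l j ≠ 0)
    {Ω : Fin 3 → Fin 3 → V →L[ℝ] ℂ} {v : V} {x η : E4} (hx : ‖x‖ = 1) (hη : inner ℝ x η = 0)
    (hΩ : (Matrix.of fun i i' => Ω i i' v) = cyc j (star (blockMatrix x) * quatMatrix η))
    (h : ∀ a, coframe k l Ω a v = 0) : η = 0 := by
  have hskew : star (Matrix.of fun i i' => Ω i i' v) = -Matrix.of fun i i' => Ω i i' v := by
    rw [hΩ, star_cyc, star_blockMatrix_mul_quatMatrix_skew hη, map_neg]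
  rw [inner_eq_re_cplx] at hη
  refine eq_zero_of_star_blockMatrix_mul_quatMatrix hx ?_
  rw [star_blockMatrix_mul_quatMatrix] at hΩ ⊢
  set w₁ := conj (cplxFst x) * cplxFst η + conj (cplxSnd x) * cplxSnd η
  set w₂ := cplxFst x * cplxSnd η - cplxSnd x * cplxFst η
  have hentry (i i' : Fin 3) :
      Ω i i' v = quatMatrix (ofCplx w₁ w₂) (relabel j i) (relabel j i') :=
    congrFun (congrFun hΩ i) i'
  have hw₂ : w₂ = 0 := by
    have h21 := hentry (j + 2) (j + 1)
    rw [apply_eq_zero_of_coframe_eq_zero hskew h (by simp)] at h21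
    simpa [quatMatrix_apply] using h21.symm
  have him : w₁.im = 0 := by
    have hsum := sum_coweight_mul_im_eq_zero hw (h 3)
    have hcw : (coweight k l (j + 1) : ℝ) - coweight k l (j + 2) = -3 * weight k l j :=
      mod_cast coweight_add_one_sub_add_two k l j
    rw [sum_fin_three_cyclic _ j] at hsum
    simp only [hentry, quatMatrix_apply, relabel_self, relabel_add_one, relabel_add_two,
      Matrix.of_apply, Matrix.cons_val, cplxFst_ofCplx, Complex.conj_im, Complex.zero_im] at hsum
    have hprod : -3 * (weight k l j : ℝ) * w₁.im = 0 := by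
      rw [← hcw]
      linear_combination hsum
    simpa [hw] using hprod
  have hw₁ : w₁ = 0 := Complex.ext hη him
  rw [hw₂, hw₁]
  exact (congrArg quatMatrix (cplx_ext (by simp) (by simp))).trans (map_zero quatMatrix)

theorem tube_immersive {V : Type*} [AddCommGroup V] [Module ℝ V] [TopologicalSpace V] {k l : ℤ}
    {g : SU3} {j : Fin 3} (hw : weight k l j ≠ 0) {Ω : Fin 3 → Fin 3 → V →L[ℝ] ℂ} {v : V}
    {b x β η : E4} (hx : ‖x‖ = 1) (hη : inner ℝ x η = 0)
    (hΩ : (Matrix.of fun i i' => Ω i i' v) =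
      star (tubeMatrix g j (b, x)) * entryDeriv (tubeMatrix g j) (b, x) (β, η))
    (h : ∀ a, coframe k l Ω a v = 0) : β = 0 ∧ η = 0 := by
  have hskew : star (Matrix.of fun i i' => Ω i i' v) = -Matrix.of fun i i' => Ω i i' v := by
    rw [hΩ, star_tubeMatrix_mul_entryDeriv_skew g j b β hη]
  have hβ : β = 0 := eq_zero_of_entryDeriv_tubeMatrix hx fun i hi => by
    rw [← hΩ]
    exact apply_eq_zero_of_coframe_eq_zero hskew h hi
  refine ⟨hβ, eq_zero_of_coframe_cyc_quatMatrix (j := j) hw hx hη ?_ h⟩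
  rw [hΩ, star_tubeMatrix_mul_entryDeriv, hβ, entryDeriv_zero, mul_zero, mul_zero, zero_mul,
    zero_add]

/-! ### The circle subgroup -/

/-- The diagonal entries `(e^{ikθ}, e^{ilθ}, e^{imθ})` of the elements of the circle. -/
def phase (k l : ℤ) (θ : ℝ) (i : Fin 3) : ℂ :=
  Complex.exp (Complex.I * (weight k l i : ℂ) * (θ : ℂ))

theorem norm_phase (k l : ℤ) (θ : ℝ) (i : Fin 3) : ‖phase k l θ i‖ = 1 := by
  rw [phase, Complex.norm_exp]
  simp

theorem prod_phase (k l : ℤ) (θ : ℝ) : ∏ i, phase k l θ i = 1 := by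
  have h : ∑ i, (weight k l i : ℂ) = 0 := by simp [weight, Fin.sum_univ_three]
  simp only [phase]
  rw [← Complex.exp_sum, ← Finset.sum_mul, ← Finset.mul_sum, h, mul_zero, zero_mul,
    Complex.exp_zero]

theorem phase_add_two {k l : ℤ} {θ : ℝ} {j : Fin 3} (h : phase k l θ j = 1) :
    phase k l θ (j + 2) = conj (phase k l θ (j + 1)) := by
  have hprod : phase k l θ j * phase k l θ (j + 1) * phase k l θ (j + 2) = 1 := by
    rw [← prod_phase k l θ, Fin.prod_univ_three]
    fin_cases j <;> simp only [Fin.reduceFinMk, Fin.reduceAdd] <;> ring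
  have hconj : phase k l θ (j + 1) * conj (phase k l θ (j + 1)) = 1 := by
    rw [Complex.mul_conj', norm_phase, Complex.ofReal_one, one_pow]
  rw [h, one_mul] at hprod
  exact mul_left_cancel₀ (left_ne_zero_of_mul_eq_one hprod) (hprod.trans hconj.symm)

/-- The element `diag(e^{ikθ}, e^{ilθ}, e^{imθ})` of the circle subgroup. -/
def circleElt (k l : ℤ) (θ : ℝ) : SU3 :=
  ⟨Matrix.diagonal (phase k l θ), by
    rw [mem_specialUnitaryGroup_iff', Matrix.det_diagonal, Matrix.star_eq_conjTranspose,
      Matrix.diagonal_conjTranspose, Matrix.diagonal_mul_diagonal, ← Matrix.diagonal_one]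
    refine ⟨congrArg _ (funext fun i => ?_), prod_phase k l θ⟩
    rw [Pi.star_apply, RCLike.star_def, Complex.conj_mul', norm_phase, Complex.ofReal_one, one_pow]⟩

theorem coe_circleElt (k l : ℤ) (θ : ℝ) :
    (circleElt k l θ).1 = Matrix.diagonal (phase k l θ) := rfl

theorem mk_eq_mk_iff {k l : ℤ} {a b : SU3} :
    (a : W k l) = (b : W k l) ↔ ∃ θ : ℝ, b = a * circleElt k l θ := by
  rw [QuotientGroup.eq]
  refine exists_congr fun θ => ?_
  rw [← inv_mul_eq_iff_eq_mul, Subtype.ext_iff]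
  rfl

theorem exists_phase_eq {k l : ℤ} {j : Fin 3} (hw : weight k l j ≠ 0) {c : ℂ} (hc : ‖c‖ = 1) :
    ∃ θ : ℝ, phase k l θ j = c := by
  have hwC : (weight k l j : ℂ) ≠ 0 := mod_cast hw
  refine ⟨c.arg / weight k l j, ?_⟩
  conv_rhs => rw [← Complex.norm_mul_exp_arg_mul_I c, hc, Complex.ofReal_one, one_mul]
  rw [phase]
  congr 1
  push_cast
  field_simp

theorem isCoprime_weight {k l : ℤ} (h : IsCoprime k l) (j : Fin 3) :
    IsCoprime (weight k l j) (weight k l (j + 1)) := by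
  fin_cases j
  · exact h
  · change IsCoprime l (-k - l)
    rw [sub_eq_add_neg, ← mul_neg_one l]
    exact IsCoprime.add_mul_left_right_iff.2 h.symm.neg_right
  · change IsCoprime (-k - l) k
    rw [sub_eq_neg_add, ← mul_neg_one k]
    exact IsCoprime.add_mul_left_left_iff.2 h.symm.neg_left

theorem weight_ne_zero {k l : ℤ} (hk : k ≠ 0) (hl : l ≠ 0) (hkl : IsCoprime k l)
    (hgen : ({k, l, -k - l} : Multiset ℤ) ≠ {1, -1, 0}) (j : Fin 3) : weight k l j ≠ 0 := by
  fin_cases j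
  · exact hk
  · exact hl
  · change -k - l ≠ 0
    intro h
    obtain rfl : l = -k := by linarith
    have hunit : IsUnit k := isCoprime_self.1 (by simpa using hkl.neg_right)
    obtain rfl | rfl := Int.isUnit_iff.1 hunit
    · exact hgen (by decide)
    · exact hgen (by decide)

theorem pow_natAbs_eq_one_iff {z : ℂ} {n : ℤ} : z ^ n.natAbs = 1 ↔ z ^ n = 1 := by
  obtain h | h := Int.natAbs_eq n
  · conv_rhs => rw [h, zpow_natCast]
  · conv_rhs => rw [h, zpow_neg, zpow_natCast, inv_eq_one]

theorem phase_pow_natAbs_eq_one {k l : ℤ} {j : Fin 3} {θ : ℝ} (h : phase k l θ j = 1)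
    (i : Fin 3) : phase k l θ i ^ (weight k l j).natAbs = 1 := by
  have hcomm : phase k l θ i ^ weight k l j = phase k l θ j ^ weight k l i := by
    rw [phase, phase, ← Complex.exp_int_mul, ← Complex.exp_int_mul]
    congr 1
    ring
  rw [pow_natAbs_eq_one_iff, hcomm, h, one_zpow]

theorem exists_phase_eq_of_pow_eq_one {k l : ℤ} (hkl : IsCoprime k l) {j : Fin 3}
    (hw : weight k l j ≠ 0) {ζ : ℂ} (hζ : ζ ^ (weight k l j).natAbs = 1) :
    ∃ θ : ℝ, phase k l θ j = 1 ∧ phase k l θ (j + 1) = ζ := by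
  obtain ⟨u, v, huv⟩ := isCoprime_weight hkl j
  have hnorm : ‖ζ‖ = 1 := Complex.norm_eq_one_of_pow_eq_one hζ (Int.natAbs_ne_zero.2 hw)
  have hζ0 : ζ ≠ 0 := norm_ne_zero_iff.1 (hnorm ▸ one_ne_zero)
  have hexp : Complex.exp (ζ.arg * Complex.I) = ζ := by
    simpa [hnorm] using Complex.norm_mul_exp_arg_mul_I ζ
  rw [pow_natAbs_eq_one_iff] at hζ
  have hphase (i : Fin 3) : phase k l (v * ζ.arg) i = ζ ^ (v * weight k l i) := by
    conv_rhs => rw [← hexp, ← Complex.exp_int_mul]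
    rw [phase]
    congr 1
    push_cast
    ring
  refine ⟨v * ζ.arg, ?_, ?_⟩
  · rw [hphase, mul_comm, zpow_mul, hζ, one_zpow]
  · rw [hphase, ← eq_sub_iff_add_eq'.2 huv |>.symm, zpow_sub₀ hζ0, mul_comm, zpow_mul, hζ, one_zpow,
      zpow_one, div_one]

/-! ### The fibres as orbits of block subgroups -/

theorem proj_mk_eq_iff {k l : ℤ} {j : Fin 3} {a b : SU3} :
    proj k l j a = proj k l j b ↔ ∃ c : ℂ, ∀ i, b.1 i j = c * a.1 i j := by
  rw [eq_comm]
  refine (Projectivization.mk_eq_mk_iff' ℂ _ _ _ _).trans (exists_congr fun c => ?_)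
  rw [funext_iff]
  exact forall_congr' fun i => eq_comm

theorem mul_block_apply_self (a : SU3) (j : Fin 3) (x : S3) (i : Fin 3) :
    (a * block j x).1 i j = a.1 i j := by
  rw [Submonoid.coe_mul, Matrix.mul_apply]
  simp only [block, cyc_blockMatrix_apply_self]
  rw [← Matrix.mul_apply, mul_one]

theorem proj_mk_mul_block (k l : ℤ) (j : Fin 3) (a : SU3) (x : S3) :
    proj k l j (a * block j x : SU3) = proj k l j a :=
  Eq.symm (proj_mk_eq_iff.2 ⟨1, fun i => by rw [mul_block_apply_self, one_mul]⟩)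

theorem star_mul_apply_of_col_eq_mul {a b : SU3} {j : Fin 3} {c : ℂ}
    (h : ∀ i, b.1 i j = c * a.1 i j) (i : Fin 3) :
    (star a.1 * b.1) i j = c * (1 : Matrix (Fin 3) (Fin 3) ℂ) i j := by
  rw [← star_coe_mul_coe a, star_mul_apply, star_mul_apply, Finset.mul_sum]
  exact Finset.sum_congr rfl fun r _ => by rw [h, mul_left_comm]

theorem norm_eq_one_of_col_eq_mul {a b : SU3} {j : Fin 3} {c : ℂ}
    (h : ∀ i, b.1 i j = c * a.1 i j) : ‖c‖ = 1 := by
  have ha := congrFun (congrFun (star_coe_mul_coe a) j) j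
  have hb := congrFun (congrFun (star_coe_mul_coe b) j) j
  rw [star_mul_apply, Matrix.one_apply_eq] at ha hb
  have hc : conj c * c = 1 := by
    rw [← hb, ← mul_one (conj c * c), ← ha, Finset.mul_sum]
    refine Finset.sum_congr rfl fun r _ => ?_
    rw [h, map_mul]
    ring
  rw [Complex.conj_mul'] at hc
  exact (pow_eq_one_iff_of_nonneg (norm_nonneg c) two_ne_zero).1 (mod_cast hc)

theorem star_eq_adjugate {n : Type*} [Fintype n] [DecidableEq n] {M : Matrix n n ℂ}
    (hM : M ∈ Matrix.specialUnitaryGroup n ℂ) : star M = M.adjugate := by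
  obtain ⟨hu, hdet⟩ := mem_specialUnitaryGroup_iff'.1 hM
  rw [← mul_one (star M), ← one_smul ℂ (1 : Matrix n n ℂ), ← hdet, ← Matrix.mul_adjugate,
    ← mul_assoc, hu, one_mul]

theorem eq_blockMatrix_of_mem {M : Matrix (Fin 3) (Fin 3) ℂ}
    (hM : M ∈ Matrix.specialUnitaryGroup (Fin 3) ℂ)
    (hcol : ∀ i, M i 2 = (1 : Matrix (Fin 3) (Fin 3) ℂ) i 2) :
    ∃ x : S3, M = blockMatrix x.1 := by
  have h0 : M 0 2 = 0 := hcol 0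
  have h1 : M 1 2 = 0 := hcol 1
  have h2 : M 2 2 = 1 := hcol 2
  have hadj (i i' : Fin 3) : conj (M i' i) = M.adjugate i i' :=
    congrFun (congrFun (star_eq_adjugate hM) i) i'
  simp only [Matrix.adjugate_fin_three] at hadj
  have h00 := hadj 0 0
  have h01 := hadj 0 1
  have h02 := hadj 0 2
  have h12 := hadj 1 2
  simp only [h0, h1, h2, Matrix.of_apply, Matrix.cons_val, mul_one, mul_zero, zero_mul, sub_zero,
    zero_add, neg_zero, sub_self, map_eq_zero] at h00 h01 h02 h12
  have hnorm : M 0 0 * conj (M 0 0) + M 1 0 * conj (M 1 0) = 1 := by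
    have h := congrFun (congrFun (mem_specialUnitaryGroup_iff'.1 hM).1 0) 0
    rw [star_mul_apply, Fin.sum_univ_three, h02, mul_zero, add_zero, Matrix.one_apply_eq] at h
    linear_combination h
  have hy : ‖ofCplx (M 0 0) (M 1 0)‖ = 1 := by
    have h := cplx_mul_conj_add (ofCplx (M 0 0) (M 1 0))
    rw [cplxFst_ofCplx, cplxSnd_ofCplx, hnorm] at h
    exact (pow_eq_one_iff_of_nonneg (norm_nonneg _) two_ne_zero).1 (mod_cast h.symm)
  refine ⟨⟨_, mem_sphere_zero_iff_norm.2 hy⟩, ?_⟩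
  rw [blockMatrix_eq, cplxFst_ofCplx, cplxSnd_ofCplx]
  ext i i'
  fin_cases i <;> fin_cases i' <;> simp [h0, h1, h2, h00, h01, h02, h12]

theorem exists_eq_block {h : SU3} {j : Fin 3}
    (hcol : ∀ i, h.1 i j = (1 : Matrix (Fin 3) (Fin 3) ℂ) i j) : ∃ x : S3, h = block j x := by
  obtain ⟨M, hM⟩ := (cyc j).surjective h.1
  have hmem : M ∈ Matrix.specialUnitaryGroup (Fin 3) ℂ := cyc_mem_iff.1 (hM ▸ h.2)
  obtain ⟨x, rfl⟩ := eq_blockMatrix_of_mem hmem fun i => by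
    have hi := hcol ((relabel j).symm i)
    rw [← hM, ← map_one (cyc j), cyc_apply, cyc_apply, relabel_self, Equiv.apply_symm_apply] at hi
    exact hi
  exact ⟨x, Subtype.ext hM.symm⟩

/-- If the `j`-th columns of `a` and `b` are proportional, an element of the circle makes them
equal, and then `a⁻¹ b` fixes the `j`-th basis vector. -/
theorem fibre_proj_mk {k l : ℤ} {j : Fin 3} (hw : weight k l j ≠ 0) (a : SU3) :
    fibre k l j (proj k l j a) = Set.range fun x : S3 => ((a * block j x : SU3) : W k l) := by
  refine Set.Subset.antisymm (fun y hy => ?_) ?_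
  · obtain ⟨b, rfl⟩ := QuotientGroup.mk_surjective y
    obtain ⟨c, hc⟩ := proj_mk_eq_iff.1 (Eq.symm hy)
    have hnorm := norm_eq_one_of_col_eq_mul hc
    obtain ⟨θ, hθ⟩ := exists_phase_eq hw (c := c⁻¹) (by rw [norm_inv, hnorm, inv_one])
    have hcol (i : Fin 3) : (b * circleElt k l θ).1 i j = a.1 i j := by
      rw [Submonoid.coe_mul, coe_circleElt, Matrix.mul_diagonal, hc, hθ, mul_right_comm,
        mul_inv_cancel₀ (norm_ne_zero_iff.1 (hnorm ▸ one_ne_zero)), one_mul]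
    obtain ⟨x, hx⟩ := exists_eq_block (h := a⁻¹ * (b * circleElt k l θ)) (j := j) fun i => by
      have hone : (1 : Matrix (Fin 3) (Fin 3) ℂ) = (a⁻¹).1 * a.1 :=
        congrArg Subtype.val (inv_mul_cancel a).symm
      rw [hone, Submonoid.coe_mul, Matrix.mul_apply, Matrix.mul_apply]
      simp only [hcol]
    exact ⟨x, (mk_eq_mk_iff.2 ⟨θ, by rw [← hx, mul_inv_cancel_left]⟩).symm⟩
  · rintro _ ⟨x, rfl⟩
    exact proj_mk_mul_block k l j a x

theorem block_eq_mul_circleElt_iff {k l : ℤ} {j : Fin 3} {x x' : S3} {θ : ℝ} :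
    block j x' = block j x * circleElt k l θ ↔
      phase k l θ j = 1 ∧ x'.1 = cmul (phase k l θ (j + 1)) x.1 := by
  have hdiag : Matrix.diagonal (phase k l θ) = cyc j (Matrix.diagonal
      ![phase k l θ (j + 1), phase k l θ (j + 2), phase k l θ j]) := by
    fin_cases j <;> ext i i' <;> fin_cases i <;> fin_cases i' <;> rfl
  rw [Subtype.ext_iff, Submonoid.coe_mul, coe_circleElt, hdiag, block, block, ← map_mul,
    (cyc j).injective.eq_iff, ← Matrix.ext_iff]
  simp only [blockMatrix_eq, Matrix.mul_diagonal]
  constructor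
  · intro h
    refine ⟨by simpa using (h 2 2).symm, cplx_ext ?_ ?_⟩
    · simpa [mul_comm] using h 0 0
    · simpa [mul_comm] using h 1 0
  · rintro ⟨h, hx⟩ i i'
    rw [hx, phase_add_two h, h]
    fin_cases i <;> fin_cases i' <;> simp [mul_comm]

theorem mk_mul_block_eq_iff {k l : ℤ} (hkl : IsCoprime k l) {j : Fin 3} (hw : weight k l j ≠ 0)
    (a : SU3) (x x' : S3) : ((a * block j x : SU3) : W k l) = (a * block j x' : SU3) ↔
      SameOrbit (weight k l j).natAbs x x' := by
  rw [mk_eq_mk_iff, sameOrbit_iff_exists_cmul]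
  simp only [mul_assoc, mul_right_inj, block_eq_mul_circleElt_iff]
  constructor
  · rintro ⟨θ, hθ, hx⟩
    exact ⟨phase k l θ (j + 1), phase_pow_natAbs_eq_one hθ _, hx⟩
  · rintro ⟨ζ, hζ, hx⟩
    obtain ⟨θ, hθ, rfl⟩ := exists_phase_eq_of_pow_eq_one hkl hw hζ
    exact ⟨θ, hθ, hx⟩

/-! ### The tube maps and the fibres -/

theorem proj_tubeBase (k l : ℤ) (g : SU3) (j : Fin 3) (b : E4) :
    proj k l j (tubeBase g j b) = linePoint g j b :=
  (Projectivization.mk_eq_mk_iff' ℂ _ _ _ _).2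
    ⟨invNorm b, funext fun i => (tubeBase_apply_self g j b i).symm⟩

theorem range_tube {k l : ℤ} {j : Fin 3} (hw : weight k l j ≠ 0) (g : SU3) (b : E4) :
    Set.range (fun x : S3 => (tube g j (b, x) : W k l)) = fibre k l j (linePoint g j b) := by
  rw [← proj_tubeBase k l, fibre_proj_mk hw]
  rfl

theorem proj_tube {k l : ℤ} {j : Fin 3} (hw : weight k l j ≠ 0) (g : SU3) (z : E4 × S3) :
    proj k l j (tube g j z) = linePoint g j z.1 :=
  (range_tube hw g z.1).subset ⟨z.2, rfl⟩

theorem tube_eq_iff {k l : ℤ} (hkl : IsCoprime k l) {j : Fin 3} (hw : weight k l j ≠ 0) (g : SU3)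
    (b b' : E4) (x x' : S3) : (tube g j (b, x) : W k l) = (tube g j (b', x') : W k l) ↔
      b = b' ∧ SameOrbit (weight k l j).natAbs x x' := by
  constructor
  · intro h
    obtain rfl : b = b' := linePoint_injective g j (by
      rw [← proj_tube hw g (b, x), ← proj_tube hw g (b', x'), h])
    exact ⟨rfl, (mk_mul_block_eq_iff hkl hw _ x x').1 h⟩
  · rintro ⟨rfl, h⟩
    exact (mk_mul_block_eq_iff hkl hw _ x x').2 h

theorem linePoint_zero (k l : ℤ) (g : SU3) (j : Fin 3) :
    linePoint g j 0 = proj k l j g := by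
  rw [← proj_tubeBase k l, tubeBase_zero]

theorem sign_relabel_trans (i j : Fin 3) :
    Equiv.Perm.sign ((relabel i).trans (relabel j).symm) = 1 := by
  revert i j; decide

theorem submatrix_relabel_mem (i j : Fin 3) {M : Matrix (Fin 3) (Fin 3) ℂ}
    (hM : M ∈ Matrix.specialUnitaryGroup (Fin 3) ℂ) :
    M.submatrix (relabel i) (relabel j) ∈ Matrix.specialUnitaryGroup (Fin 3) ℂ := by
  have hu := (mem_specialUnitaryGroup_iff'.1 hM).1
  refine mem_specialUnitaryGroup_iff'.2 ⟨?_, ?_⟩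
  · rw [Matrix.star_eq_conjTranspose, Matrix.conjTranspose_submatrix, Matrix.submatrix_mul_equiv,
      ← Matrix.star_eq_conjTranspose, hu, Matrix.submatrix_one_equiv]
  · have h : M.submatrix (relabel i) (relabel j) =
        (cyc j M).submatrix ((relabel i).trans (relabel j).symm) id := by
      ext r s
      simp [cyc_apply]
    rw [h, Matrix.det_permute, (mem_specialUnitaryGroup_iff'.1 (cyc_mem_iff.2 hM)).2,
      sign_relabel_trans, Units.val_one, Int.cast_one, mul_one]

theorem exists_linePoint_zero_eq (j : Fin 3) (x : CP2) : ∃ g : SU3, linePoint g j 0 = x := by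
  induction x using Projectivization.ind with
  | h v hv =>
    obtain ⟨i, hi : v i ≠ 0⟩ := Function.ne_iff.1 hv
    have hcases : ∀ r, r = i ∨ r = i + 1 ∨ r = i + 2 := by clear hi; revert i; decide
    let b : E4 := ofCplx (v (i + 1) / v i) (v (i + 2) / v i)
    have haffine (r : Fin 3) : affineVec b (relabel i r) = v r / v i := by
      obtain rfl | rfl | rfl := hcases r
      all_goals simp [affineVec, b, hi]
    refine ⟨⟨_, submatrix_relabel_mem i j (affineFrame b).2⟩, ?_⟩
    rw [linePoint_zero 0 0]
    refine (Projectivization.mk_eq_mk_iff' ℂ _ _ _ _).2 ⟨invNorm b / v i, funext fun r => ?_⟩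
    have hcol := affineFrame_apply_two b (relabel i r)
    rw [haffine, ← relabel_self j, ← mul_div_assoc, mul_div_right_comm] at hcol
    exact hcol.symm

/-! ### The family of fibres -/

instance fact_finrank_euclideanSpace_four :
    Fact (Module.finrank ℝ (EuclideanSpace ℝ (Fin (3 + 1))) = 3 + 1) :=
  ⟨finrank_euclideanSpace_fin⟩

/-- The inclusion of `ℝ⁴ × S³` in `ℝ⁴ × ℝ⁴`. -/
def tubeIncl (z : E4 × S3) : E4 × E4 := (z.1, z.2.1)

theorem contMDiff_tubeIncl :
    ContMDiff ((𝓘(ℝ, E4)).prod (𝓡 3)) 𝓘(ℝ, E4 × E4) ∞ tubeIncl :=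
  contMDiff_fst.prodMk_space
    ((contMDiff_coe_sphere (n := 3) (E := EuclideanSpace ℝ (Fin (3 + 1)))).comp contMDiff_snd)

theorem tube_apply_eq_comp (g : SU3) (j i i' : Fin 3) :
    (fun z => (tube g j z : Matrix (Fin 3) (Fin 3) ℂ) i i') =
      (fun z => tubeMatrix g j z i i') ∘ tubeIncl := rfl

theorem contMDiff_tube (g : SU3) (j i i' : Fin 3) :
    ContMDiff ((𝓘(ℝ, E4)).prod (𝓡 3)) 𝓘(ℝ, ℂ) ∞ fun z =>
      (tube g j z : Matrix (Fin 3) (Fin 3) ℂ) i i' := by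
  rw [tube_apply_eq_comp]
  exact (contDiff_tubeMatrix g j i i').contMDiff.comp contMDiff_tubeIncl

theorem mfderiv_tubeIncl (z : E4 × S3) (v : TangentSpace ((𝓘(ℝ, E4)).prod (𝓡 3)) z) :
    mfderiv ((𝓘(ℝ, E4)).prod (𝓡 3)) 𝓘(ℝ, E4 × E4) tubeIncl z v =
      (v.1, mvfderiv (𝓡 3) ((↑) : S3 → EuclideanSpace ℝ (Fin (3 + 1))) z.2 v.2) := by
  have hincl := (contMDiff_tubeIncl.mdifferentiableAt (x := z) (by simp)).hasMFDerivAt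
  have hcoe := ((contMDiff_coe_sphere (m := 1) (n := 3)
    (E := EuclideanSpace ℝ (Fin (3 + 1)))).mdifferentiableAt (x := z.2) (by simp)).hasMFDerivAt
  have hfst := hasMFDerivAt_unique
    ((hasFDerivAt_fst (𝕜 := ℝ) (p := tubeIncl z)).hasMFDerivAt.comp z hincl)
    (hasMFDerivAt_fst (I := 𝓘(ℝ, E4)) (I' := 𝓡 3) z)
  have hsnd := hasMFDerivAt_unique
    ((hasFDerivAt_snd (𝕜 := ℝ) (p := tubeIncl z)).hasMFDerivAt.comp z hincl)
    (hcoe.comp z (hasMFDerivAt_snd (I := 𝓘(ℝ, E4)) (I' := 𝓡 3) z))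
  exact Prod.ext (congrArg (fun L => L v) hfst) (congrArg (fun L => L v) hsnd)

theorem pullMCProd_tube (g : SU3) (j : Fin 3) (z : E4 × S3)
    (v : TangentSpace ((𝓘(ℝ, E4)).prod (𝓡 3)) z) :
    (Matrix.of fun i i' => pullMCProd (tube g j) z i i' v) =
      star (tubeMatrix g j (z.1, z.2.1)) * entryDeriv (tubeMatrix g j) (z.1, z.2.1)
        (v.1, mvfderiv (𝓡 3) ((↑) : S3 → EuclideanSpace ℝ (Fin (3 + 1))) z.2 v.2) := by
  have hderiv (i i' : Fin 3) : mfderiv ((𝓘(ℝ, E4)).prod (𝓡 3)) 𝓘(ℝ, ℂ)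
      (fun y => (tube g j y : Matrix (Fin 3) (Fin 3) ℂ) i i') z v =
        fderiv ℝ (fun y => tubeMatrix g j y i i') (tubeIncl z)
          (mfderiv ((𝓘(ℝ, E4)).prod (𝓡 3)) 𝓘(ℝ, E4 × E4) tubeIncl z v) := by
    have hmat : MDifferentiableAt 𝓘(ℝ, E4 × E4) 𝓘(ℝ, ℂ) (fun y => tubeMatrix g j y i i')
        (tubeIncl z) :=
      ((contDiff_tubeMatrix g j i i').differentiable (by simp) _).mdifferentiableAt
    have hcomp := mfderiv_comp z hmat (contMDiff_tubeIncl.mdifferentiableAt (by simp))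
    rw [mfderiv_eq_fderiv, ← tube_apply_eq_comp] at hcomp
    exact congrArg (fun L => L v) hcomp
  ext i i'
  have hmc := maurerCartan_apply (tube g j z) (fun i i' => mfderiv ((𝓘(ℝ, E4)).prod (𝓡 3))
    𝓘(ℝ, ℂ) (fun y => (tube g j y : Matrix (Fin 3) (Fin 3) ℂ) i i') z) i i' v
  refine hmc.trans (congrFun (congrFun (congrArg (star (tube g j z).1 * ·) ?_) i) i')
  ext r s
  exact (hderiv r s).trans (congrArg _ (mfderiv_tubeIncl z v))

theorem pullMCProd_tube_immersive {k l : ℤ} {g : SU3} {j : Fin 3} (hw : weight k l j ≠ 0)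
    {z : E4 × S3} {v : TangentSpace ((𝓘(ℝ, E4)).prod (𝓡 3)) z}
    (hv : ∀ a, coframe k l (pullMCProd (tube g j) z) a v = 0) : v = 0 := by
  have horth : mvfderiv (𝓡 3) ((↑) : S3 → EuclideanSpace ℝ (Fin (3 + 1))) z.2 v.2 ∈
      (ℝ ∙ (z.2 : EuclideanSpace ℝ (Fin (3 + 1))))ᗮ := by
    rw [← range_mvfderiv_subtypeVal (n := 3) (E := EuclideanSpace ℝ (Fin (3 + 1)))]
    exact ⟨v.2, rfl⟩
  obtain ⟨h₁, h₂⟩ := tube_immersive hw (norm_eq_of_mem_sphere z.2)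
    (Submodule.mem_orthogonal_singleton_iff_inner_right.1 horth) (pullMCProd_tube g j z v) hv
  refine Prod.ext h₁ ?_
  apply injective_mvfderiv_subtypeVal_sphere (n := 3) (E := EuclideanSpace ℝ (Fin (3 + 1))) z.2
  rw [h₂]
  exact (map_zero _).symm

theorem isSpaceFormFamily_fibre {k l : ℤ} (hkl : IsCoprime k l) {j : Fin 3}
    (hw : weight k l j ≠ 0) :
    IsSpaceFormFamily k l (weight k l j).natAbs (fibre k l j) := by
  refine ⟨fun x y hxy => Disjoint.preimage _ (Set.disjoint_singleton.2 hxy), fun x₀ => ?_⟩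
  obtain ⟨g, hg⟩ := exists_linePoint_zero_eq j x₀
  exact ⟨lineVec g j, linePoint g j, Set.univ, tube g j, isCP2Chart_lineVec g j, ⟨0, trivial, hg⟩,
    fun i i' => (contMDiff_tube g j i i').contMDiffOn, fun z _ v => pullMCProd_tube_immersive hw,
    fun b _ b' _ x x' => tube_eq_iff hkl hw g b b' x x', fun b _ => range_tube hw g b⟩

/-! ### The fibres are embedded submanifolds -/

/-- The last four coordinates, transverse to the slice `ℝ³ × 0` of `ℝ⁷`. -/
def normalPart : E7 →L[ℝ] E4 :=
  ((EuclideanSpace.equiv (Fin 4) ℝ).symm : (Fin 4 → ℝ) →L[ℝ] E4) ∘L ContinuousLinearMap.pi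
    ![EuclideanSpace.proj 3, EuclideanSpace.proj 4, EuclideanSpace.proj 5, EuclideanSpace.proj 6]

/-- The first three coordinates, as the hyperplane of `ℝ⁴` on which the first coordinate
vanishes. -/
def tangentPart : E7 →L[ℝ] E4 :=
  ((EuclideanSpace.equiv (Fin 4) ℝ).symm : (Fin 4 → ℝ) →L[ℝ] E4) ∘L ContinuousLinearMap.pi
    ![0, EuclideanSpace.proj 0, EuclideanSpace.proj 1, EuclideanSpace.proj 2]

theorem normalPart_eq_zero_iff {z : E7} :
    normalPart z = 0 ↔ z 3 = 0 ∧ z 4 = 0 ∧ z 5 = 0 ∧ z 6 = 0 := by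
  rw [PiLp.ext_iff, Fin.forall_fin_succ, Fin.forall_fin_succ, Fin.forall_fin_two]
  rfl

theorem eq_of_normalPart_eq_of_tangentPart_eq {z z' : E7} (hn : normalPart z = normalPart z')
    (ht : tangentPart z = tangentPart z') : z = z' := by
  rw [PiLp.ext_iff] at hn ht ⊢
  intro i
  fin_cases i
  exacts [ht 1, ht 2, ht 3, hn 0, hn 1, hn 2, hn 3]

/-- The point `(1, z₀, z₁, z₂)` of the affine hyperplane tangent to the sphere at `(1, 0, 0, 0)`. -/
def hemiVec (z : E7) : E4 := EuclideanSpace.single 0 1 + tangentPart z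

/-- The central projection of `hemiVec z` to the upper hemisphere. -/
def hemisphere (z : E7) : E4 := ‖hemiVec z‖⁻¹ • hemiVec z

theorem hemiVec_apply_zero (z : E7) : hemiVec z 0 = 1 := by
  simp [hemiVec, tangentPart]

theorem hemiVec_ne_zero (z : E7) : hemiVec z ≠ 0 := fun h => by
  simpa [h] using hemiVec_apply_zero z

theorem norm_hemisphere (z : E7) : ‖hemisphere z‖ = 1 :=
  norm_smul_inv_norm (𝕜 := ℝ) (hemiVec_ne_zero z)

theorem hemisphere_zero : hemisphere 0 = EuclideanSpace.single 0 1 := by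
  simp [hemisphere, hemiVec]

theorem hasFDerivAt_hemiVec (z : E7) : HasFDerivAt hemiVec tangentPart z :=
  tangentPart.hasFDerivAt.const_add _

theorem contDiff_hemiVec : ContDiff ℝ ∞ hemiVec := contDiff_const.add tangentPart.contDiff

theorem contDiff_inv_norm_hemiVec : ContDiff ℝ ∞ fun z => ‖hemiVec z‖⁻¹ :=
  (contDiff_hemiVec.norm ℝ hemiVec_ne_zero).inv fun z => norm_ne_zero_iff.2 (hemiVec_ne_zero z)

theorem contDiff_hemisphere : ContDiff ℝ ∞ hemisphere :=
  contDiff_inv_norm_hemiVec.smul contDiff_hemiVec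

theorem hemiVec_eq_smul_hemisphere (z : E7) :
    hemiVec z = (hemisphere z 0)⁻¹ • hemisphere z := by
  have h : hemisphere z 0 = ‖hemiVec z‖⁻¹ := by simp [hemisphere, hemiVec_apply_zero]
  rw [h, hemisphere, inv_inv, smul_inv_smul₀ (norm_ne_zero_iff.2 (hemiVec_ne_zero z))]

theorem tangentPart_eq_of_hemisphere_eq {z z' : E7} (h : hemisphere z = hemisphere z') :
    tangentPart z = tangentPart z' := by
  have hvec : hemiVec z = hemiVec z' := by
    rw [hemiVec_eq_smul_hemisphere, h, ← hemiVec_eq_smul_hemisphere]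
  exact add_left_cancel hvec

theorem tangentPart_eq_zero_of_fderiv_hemisphere {z v : E7} (h : fderiv ℝ hemisphere z v = 0) :
    tangentPart v = 0 := by
  obtain ⟨c, hc⟩ := exists_fderiv_eq_smul_of_fderiv_smul (𝕜 := ℝ) (c := 0)
    (contDiff_inv_norm_hemiVec.differentiable (by simp) z)
    (hasFDerivAt_hemiVec z).differentiableAt (inv_ne_zero (norm_ne_zero_iff.2 (hemiVec_ne_zero z)))
    (h.trans (zero_smul ℝ _).symm)
  rw [(hasFDerivAt_hemiVec z).fderiv] at hc
  have hc0 : c = 0 := by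
    simpa [tangentPart, hemiVec_apply_zero] using (congrArg (fun y : E4 => y 0) hc).symm
  rw [hc, hc0, zero_smul]

theorem inner_fderiv_eq_zero_of_norm_eq_one {E F : Type*} [NormedAddCommGroup E] [NormedSpace ℝ E]
    [NormedAddCommGroup F] [InnerProductSpace ℝ F] {f : E → F} {z : E}
    (hf : DifferentiableAt ℝ f z) (hnorm : ∀ y, ‖f y‖ = 1) (v : E) :
    inner ℝ (f z) (fderiv ℝ f z v) = 0 := by
  have h := hf.hasFDerivAt.norm_sq.fderiv
  simp only [hnorm, fderiv_fun_const] at h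
  simpa using (congrArg (fun L => L v) h).symm

theorem exists_isolating_radius {p : ℕ} (hp : p ≠ 0) :
    ∃ ε > 0, ∀ ζ : ℂ, ζ ^ p = 1 → ‖ζ - 1‖ < ε → ζ = 1 := by
  have hfin : Set.Finite {ζ : ℂ | ζ ^ p = 1 ∧ ζ ≠ 1} :=
    (Polynomial.nthRootsFinset p (1 : ℂ)).finite_toSet.subset fun ζ hζ =>
      (Polynomial.mem_nthRootsFinset (Nat.pos_of_ne_zero hp) _).2 hζ.1
  obtain ⟨ε, hε, h⟩ := Metric.isOpen_iff.1 hfin.isClosed.isOpen_compl 1 (by simp)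
  exact ⟨ε, hε, fun ζ hζ hlt => by_contra fun hne =>
    h (mem_ball_iff_norm.2 hlt) ⟨hζ, hne⟩⟩

/-- Coordinates on `W_{k,l}` around `[g]` adapted to the `j`-th projection. -/
def fibreChart (g : SU3) (j : Fin 3) (z : E7) : SU3 :=
  tube g j (normalPart z, ⟨hemisphere z, by simp [norm_hemisphere]⟩)

theorem fibreChart_zero (g : SU3) (j : Fin 3) : fibreChart g j 0 = g := by
  have hfst : cplxFst (EuclideanSpace.single 0 1) = 1 := by
    apply Complex.ext <;> simp [cplxFst_apply]
  have hsnd : cplxSnd (EuclideanSpace.single 0 1) = 0 := by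
    apply Complex.ext <;> simp [cplxSnd_apply]
  have hblock : blockMatrix (EuclideanSpace.single 0 1) = 1 := by
    ext i i'
    fin_cases i <;> fin_cases i' <;> simp [blockMatrix_eq, hfst, hsnd]
  ext1
  change tubeMatrix g j (normalPart 0, hemisphere 0) = g
  rw [hemisphere_zero, map_zero, tubeMatrix, tubeBase_zero, hblock, map_one, mul_one]

theorem contDiff_fibreChart (g : SU3) (j i i' : Fin 3) :
    ContDiff ℝ ∞ fun z => (fibreChart g j z : Matrix (Fin 3) (Fin 3) ℂ) i i' :=
  (contDiff_tubeMatrix g j i i').comp (f := fun z => (normalPart z, hemisphere z))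
    (normalPart.contDiff.prodMk contDiff_hemisphere)

theorem proj_fibreChart {k l : ℤ} {j : Fin 3} (hw : weight k l j ≠ 0) (g : SU3) (z : E7) :
    proj k l j (fibreChart g j z) = linePoint g j (normalPart z) :=
  proj_tube hw g _

theorem pullMC_apply {E : Type*} [NormedAddCommGroup E] [NormedSpace ℝ E] (ψ : E → SU3) (x v : E) :
    (Matrix.of fun i j => pullMC ψ x i j v) = star (ψ x : Matrix (Fin 3) (Fin 3) ℂ) *
      entryDeriv (fun y => (ψ y : Matrix (Fin 3) (Fin 3) ℂ)) x v := by
  ext i j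
  exact maurerCartan_apply (ψ x)
    (fun i j => fderiv ℝ (fun y => (ψ y : Matrix (Fin 3) (Fin 3) ℂ) i j) x) i j v

theorem pullMC_fibreChart_immersive {k l : ℤ} {g : SU3} {j : Fin 3} (hw : weight k l j ≠ 0)
    {z v : E7} (hv : ∀ a, coframe k l (pullMC (fibreChart g j) z) a v = 0) : v = 0 := by
  have hhemi := contDiff_hemisphere.differentiable (by simp) z
  have hMC := (pullMC_apply (fibreChart g j) z v).trans (congrArg (star (fibreChart g j z).1 * ·)
    (entryDeriv_comp (F := tubeMatrix g j) (f := fun z => (normalPart z, hemisphere z))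
      (fun i i' => (contDiff_tubeMatrix g j i i').differentiable (by simp) _)
      (normalPart.differentiableAt.prodMk hhemi) v))
  rw [(normalPart.hasFDerivAt.prodMk hhemi.hasFDerivAt).fderiv] at hMC
  obtain ⟨hn, ht⟩ := tube_immersive hw (norm_hemisphere z)
    (inner_fderiv_eq_zero_of_norm_eq_one hhemi norm_hemisphere v) hMC hv
  exact eq_of_normalPart_eq_of_tangentPart_eq (hn.trans (map_zero _).symm)
    ((tangentPart_eq_zero_of_fderiv_hemisphere ht).trans (map_zero _).symm)

theorem exists_isChart_fibreChart {k l : ℤ} (hkl : IsCoprime k l) {j : Fin 3}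
    (hw : weight k l j ≠ 0) (g : SU3) :
    ∃ U : Set E7, (0 : E7) ∈ U ∧ IsChart k l (fibreChart g j) U := by
  obtain ⟨ε, hε, hroot⟩ := exists_isolating_radius (Int.natAbs_ne_zero.2 hw)
  refine ⟨hemisphere ⁻¹' Metric.ball (hemisphere 0) (ε / 2), by simpa using hε,
    Metric.isOpen_ball.preimage contDiff_hemisphere.continuous,
    fun i i' => (contDiff_fibreChart g j i i').contDiffOn,
    fun z _ v => pullMC_fibreChart_immersive hw, fun z hz z' hz' h => ?_⟩
  obtain ⟨hn, horbit⟩ := (tube_eq_iff hkl hw g _ _ _ _).1 h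
  obtain ⟨ζ, hζ, hcmul⟩ := sameOrbit_iff_exists_cmul.1 horbit
  change hemisphere z' = cmul ζ (hemisphere z) at hcmul
  have hlt : ‖hemisphere z' - hemisphere z‖ < ε := by
    rw [← dist_eq_norm, ← add_halves ε]
    exact (dist_triangle_right _ _ _).trans_lt (add_lt_add hz' hz)
  rw [hcmul, norm_cmul_sub_self, norm_hemisphere, mul_one] at hlt
  rw [hroot ζ hζ hlt, one_cmul] at hcmul
  exact eq_of_normalPart_eq_of_tangentPart_eq hn (tangentPart_eq_of_hemisphere_eq hcmul.symm)

theorem isEmbeddedThreefold_fibre {k l : ℤ} (hkl : IsCoprime k l) {j : Fin 3}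
    (hw : weight k l j ≠ 0) (x : CP2) : IsEmbeddedThreefold k l (fibre k l j x) := by
  rintro ⟨g⟩ (rfl : proj k l j (g : W k l) = x)
  obtain ⟨U, h0, hU⟩ := exists_isChart_fibreChart hkl hw g
  refine ⟨fibreChart g j, U, 0, hU, h0, by rw [fibreChart_zero]; rfl, fun z _ => ?_⟩
  rw [← normalPart_eq_zero_iff, fibre, Set.mem_preimage, Set.mem_singleton_iff, proj_fibreChart hw,
    ← linePoint_zero, (linePoint_injective g j).eq_iff]

/-! ### Second fundamental forms and structure equations -/

section FirstDerivatives

variable {E F G : Type*} [NormedAddCommGroup E] [NormedSpace ℝ E] [NormedAddCommGroup F]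
  [NormedSpace ℝ F] [NormedAddCommGroup G] [NormedSpace ℝ G]

theorem fderiv_clm_apply_const {η : E → F →L[ℝ] G} {x : E} (hη : DifferentiableAt ℝ η x) (v : F)
    (w : E) : fderiv ℝ (fun y => η y v) x w = fderiv ℝ η x w v := by
  rw [fderiv_clm_apply hη (differentiableAt_const v)]
  simp

theorem differentiableAt_fderiv {f : E → F} {x : E} (hf : ContDiffAt ℝ 2 f x) :
    DifferentiableAt ℝ (fderiv ℝ f) x :=
  (hf.fderiv_right (m := 1) one_add_one_eq_two.le).differentiableAt one_ne_zero

theorem fderiv_clm_comp_fderiv {η : F → F →L[ℝ] G} {u : E → F} {b : E}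
    (hη : DifferentiableAt ℝ η (u b)) (hu : ContDiffAt ℝ 2 u b) (t : E) :
    fderiv ℝ (fun b' => η (u b') (fderiv ℝ u b' t)) b t =
      fderiv ℝ η (u b) (fderiv ℝ u b t) (fderiv ℝ u b t) +
        η (u b) (fderiv ℝ (fderiv ℝ u) b t t) := by
  have hηu : HasFDerivAt (fun b' => η (u b')) _ b :=
    hη.hasFDerivAt.comp b (hu.differentiableAt two_ne_zero).hasFDerivAt
  have hdu := (differentiableAt_fderiv hu).hasFDerivAt.clm_apply (hasFDerivAt_const t b)
  rw [(hηu.clm_apply hdu).fderiv]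
  simp [add_comm]

end FirstDerivatives

section CoframeMetric

variable {ι : Type*} [Fintype ι] {η : ι → E7 → E7 →L[ℝ] ℝ}

theorem christoffel_sum_mul {y : E7} (hη : ∀ a, DifferentiableAt ℝ (η a) y) (p n : E7) :
    christoffel (fun y u v => ∑ a, η a y u * η a y v) y p p n =
      ∑ a, (fderiv ℝ (η a) y p p * η a y n +
        η a y p * (fderiv ℝ (η a) y p n - fderiv ℝ (η a) y n p)) := by
  have hdiff (a : ι) (v : E7) : DifferentiableAt ℝ (fun y => η a y v) y :=
    (hη a).clm_apply (differentiableAt_const v)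
  have hmetric (u v w : E7) : fderiv ℝ (fun y => ∑ a, η a y u * η a y v) y w =
      ∑ a, (η a y u * fderiv ℝ (η a) y w v + η a y v * fderiv ℝ (η a) y w u) := by
    rw [fderiv_fun_sum fun a _ => (hdiff a u).fun_mul (hdiff a v), sum_apply]
    refine Finset.sum_congr rfl fun a _ => ?_
    rw [fderiv_fun_mul (hdiff a u) (hdiff a v), add_apply, smul_apply, smul_apply,
      fderiv_clm_apply_const (hη a), fderiv_clm_apply_const (hη a), smul_eq_mul, smul_eq_mul]
  simp only [christoffel, hmetric]
  rw [← Finset.sum_add_distrib, ← Finset.sum_sub_distrib, Finset.mul_sum]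
  exact Finset.sum_congr rfl fun a _ => by ring

/-- If each 1-form of an orthonormal coframe vanishes either on the submanifold parametrised by `u`
or on the normal vector `n`, only the exterior derivatives of the coframe contribute to the second
fundamental form. -/
theorem second_fundamental_form_eq_sum_mul_d {u : E3 → E7} {b : E3}
    (hη : ∀ a, DifferentiableAt ℝ (η a) (u b)) (hu : ContDiffAt ℝ 2 u b) (t : E3) {n : E7}
    (h : ∀ a, η a (u b) n = 0 ∨ ∀ᶠ b' in nhds b, η a (u b') (fderiv ℝ u b' t) = 0) :
    ∑ a, η a (u b) (fderiv ℝ (fderiv ℝ u) b t t) * η a (u b) n +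
        christoffel (fun y v w => ∑ a, η a y v * η a y w) (u b) (fderiv ℝ u b t)
          (fderiv ℝ u b t) n =
      ∑ a, η a (u b) (fderiv ℝ u b t) * (fderiv ℝ (η a) (u b) (fderiv ℝ u b t) n -
        fderiv ℝ (η a) (u b) n (fderiv ℝ u b t)) := by
  rw [christoffel_sum_mul hη, ← Finset.sum_add_distrib]
  refine Finset.sum_congr rfl fun a _ => ?_
  have hcancel : (fderiv ℝ (η a) (u b) (fderiv ℝ u b t) (fderiv ℝ u b t) +
      η a (u b) (fderiv ℝ (fderiv ℝ u) b t t)) * η a (u b) n = 0 := by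
    rcases h a with hn | htangent
    · rw [hn, mul_zero]
    · rw [← fderiv_clm_comp_fderiv (hη a) hu, Filter.EventuallyEq.fderiv_eq htangent]
      simp
  linear_combination hcancel

end CoframeMetric

section StructureEquation

variable {E : Type*} [NormedAddCommGroup E] [NormedSpace ℝ E] {ψ : E → SU3} {y : E}

theorem pullMC_skew
    (h : ∀ i j, DifferentiableAt ℝ (fun y => (ψ y : Matrix (Fin 3) (Fin 3) ℂ) i j) y)
    (i j : Fin 3) (v : E) : pullMC ψ y i j v = -conj (pullMC ψ y j i v) := by
  have hskew := star_mul_entryDeriv_skew h v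
  rw [← pullMC_apply, star_eq_iff_star_eq, star_neg, eq_comm] at hskew
  exact congrFun₂ hskew i j

theorem differentiableAt_pullMC
    (h : ∀ i j, ContDiffAt ℝ 2 (fun y => (ψ y : Matrix (Fin 3) (Fin 3) ℂ) i j) y) (i j : Fin 3) :
    DifferentiableAt ℝ (fun y => pullMC ψ y i j) y := by
  change DifferentiableAt ℝ (fun y => ∑ r, conj ((ψ y : Matrix (Fin 3) (Fin 3) ℂ) r i) •
    fderiv ℝ (fun y => (ψ y : Matrix (Fin 3) (Fin 3) ℂ) r j) y) y
  exact DifferentiableAt.fun_sum fun r _ => DifferentiableAt.fun_smul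
    ((Complex.conjCLE : ℂ →L[ℝ] ℂ).differentiableAt.comp y
      ((h r i).differentiableAt two_ne_zero))
    (differentiableAt_fderiv (h r j))

theorem fderiv_pullMC
    (h : ∀ i j, ContDiffAt ℝ 2 (fun y => (ψ y : Matrix (Fin 3) (Fin 3) ℂ) i j) y) (p n : E) :
    (Matrix.of fun i j => fderiv ℝ (fun y => pullMC ψ y i j) y p n) =
      star (ψ y : Matrix (Fin 3) (Fin 3) ℂ) * entryDeriv
        (fun y' => entryDeriv (fun y => (ψ y : Matrix (Fin 3) (Fin 3) ℂ)) y' n) y p -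
      (Matrix.of fun i j => pullMC ψ y i j p) * (Matrix.of fun i j => pullMC ψ y i j n) := by
  have hψ i j := (h i j).differentiableAt two_ne_zero
  have hstar : ∀ i j, DifferentiableAt ℝ
      (fun y => star (ψ y : Matrix (Fin 3) (Fin 3) ℂ) i j) y := fun i j =>
    (Complex.conjCLE : ℂ →L[ℝ] ℂ).differentiableAt.comp y (hψ j i)
  have hsecond : ∀ i j, DifferentiableAt ℝ
      (fun y' => entryDeriv (fun y => (ψ y : Matrix (Fin 3) (Fin 3) ℂ)) y' n i j) y := fun i j =>
    (differentiableAt_fderiv (h i j)).clm_apply (differentiableAt_const n)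
  have hentry : (Matrix.of fun i j => fderiv ℝ (fun y => pullMC ψ y i j) y p n) =
      entryDeriv (fun y' => star (ψ y' : Matrix (Fin 3) (Fin 3) ℂ) *
        entryDeriv (fun y => (ψ y : Matrix (Fin 3) (Fin 3) ℂ)) y' n) y p := by
    ext i j
    simp only [← pullMC_apply]
    exact (fderiv_clm_apply_const (differentiableAt_pullMC h i j) n p).symm
  have hstar_entryDeriv :
      star (entryDeriv (fun y => (ψ y : Matrix (Fin 3) (Fin 3) ℂ)) y p) =
        -((Matrix.of fun i j => pullMC ψ y i j p) * star (ψ y : Matrix (Fin 3) (Fin 3) ℂ)) := by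
    rw [pullMC_apply, ← neg_mul, ← star_mul_entryDeriv_skew hψ, star_mul, star_star, mul_assoc,
      coe_mul_star_coe, mul_one]
  rw [hentry, entryDeriv_mul hstar hsecond, entryDeriv_star hψ, hstar_entryDeriv,
    pullMC_apply ψ y n, neg_mul, mul_assoc]
  exact neg_add_eq_sub _ _

/-- The Maurer–Cartan equation `dΩ = -Ω ∧ Ω`. -/
theorem fderiv_pullMC_sub_fderiv_pullMC
    (h : ∀ i j, ContDiffAt ℝ 2 (fun y => (ψ y : Matrix (Fin 3) (Fin 3) ℂ) i j) y) (p n : E) :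
    (Matrix.of fun i j => fderiv ℝ (fun y => pullMC ψ y i j) y p n) -
        (Matrix.of fun i j => fderiv ℝ (fun y => pullMC ψ y i j) y n p) =
      (Matrix.of fun i j => pullMC ψ y i j n) * (Matrix.of fun i j => pullMC ψ y i j p) -
        (Matrix.of fun i j => pullMC ψ y i j p) * (Matrix.of fun i j => pullMC ψ y i j n) := by
  have hsymm :
      entryDeriv (fun y' => entryDeriv (fun y => (ψ y : Matrix (Fin 3) (Fin 3) ℂ)) y' n) y p =
      entryDeriv (fun y' => entryDeriv (fun y => (ψ y : Matrix (Fin 3) (Fin 3) ℂ)) y' p) y n := by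
    ext r s
    have hd := differentiableAt_fderiv (h r s)
    exact (fderiv_clm_apply_const hd n p).trans (((h r s).isSymmSndFDerivAt (by simp) p n).trans
      (fderiv_clm_apply_const hd p n).symm)
  rw [fderiv_pullMC h, fderiv_pullMC h, hsymm]
  abel

/-- The scaled coframe as a linear function of the Maurer–Cartan form. -/
def scaledCoframeCLM (E : Type*) [NormedAddCommGroup E] [NormedSpace ℝ E] [FiniteDimensional ℝ E]
    (k l : ℤ) (A B C D : ℝ) (a : Fin 7) :
    (Fin 3 → Fin 3 → E →L[ℝ] ℂ) →L[ℝ] (E →L[ℝ] ℝ) :=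
  LinearMap.toContinuousLinearMap
    { toFun := fun Ω => scaledCoframe k l A B C D Ω a
      map_add' := fun Ω Ω' => by
        ext v
        fin_cases a <;> simp [scaledCoframe, coframe, Fin.sum_univ_three]
        ring
      map_smul' := fun c Ω => by
        ext v
        fin_cases a <;> simp [scaledCoframe, coframe, Fin.sum_univ_three] <;> ring }

theorem hasFDerivAt_scaledCoframe [FiniteDimensional ℝ E] (k l : ℤ) (A B C D : ℝ)
    (h : ∀ i j, ContDiffAt ℝ 2 (fun y => (ψ y : Matrix (Fin 3) (Fin 3) ℂ) i j) y) (a : Fin 7) :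
    HasFDerivAt (fun y => scaledCoframe k l A B C D (pullMC ψ y) a)
      ((scaledCoframeCLM E k l A B C D a).comp (ContinuousLinearMap.pi fun i =>
        ContinuousLinearMap.pi fun j => fderiv ℝ (fun y => pullMC ψ y i j) y)) y :=
  (scaledCoframeCLM E k l A B C D a).hasFDerivAt.comp y (hasFDerivAt_pi.2 fun i =>
    hasFDerivAt_pi.2 fun j => (differentiableAt_pullMC h i j).hasFDerivAt)

theorem fderiv_scaledCoframe [FiniteDimensional ℝ E] (k l : ℤ) (A B C D : ℝ)
    (h : ∀ i j, ContDiffAt ℝ 2 (fun y => (ψ y : Matrix (Fin 3) (Fin 3) ℂ) i j) y) (a : Fin 7)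
    (p n : E) : fderiv ℝ (fun y => scaledCoframe k l A B C D (pullMC ψ y) a) y p n =
      scaledCoframe k l A B C D (fun i j => fderiv ℝ (fun y => pullMC ψ y i j) y p) a n := by
  rw [(hasFDerivAt_scaledCoframe k l A B C D h a).fderiv]
  rfl

end StructureEquation

section WedgeOfOrthonormal

variable {V : Type*} [AddCommGroup V] [Module ℝ V] [TopologicalSpace V] {p : ℕ}
  {η : Fin p → V →L[ℝ] ℝ} {v : Fin p → V}

theorem components_mul_transpose_eq_one
    (h : ∀ i j, ∑ a, η a (v i) * η a (v j) = if i = j then 1 else 0) :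
    (Matrix.of fun i a => η a (v i)) * (Matrix.of fun i a => η a (v i)).transpose = 1 := by
  ext i j
  exact (h i j).trans (Matrix.one_apply).symm

theorem abs_wedge_eq_one (h : ∀ i j, ∑ a, η a (v i) * η a (v j) = if i = j then 1 else 0) :
    |wedge η v| = 1 := by
  have hdet := congrArg Matrix.det (components_mul_transpose_eq_one h)
  rw [Matrix.det_mul, Matrix.det_transpose, Matrix.det_one, ← wedge_apply] at hdet
  exact (abs_eq zero_le_one).2 (mul_self_eq_one_iff.1 hdet)

theorem apply_eq_zero_of_orthogonal
    (h : ∀ i j, ∑ a, η a (v i) * η a (v j) = if i = j then 1 else 0) {n : V}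
    (hn : ∀ i, ∑ a, η a (v i) * η a n = 0) (a : Fin p) : η a n = 0 := by
  have hinv := mul_eq_one_comm.1 (components_mul_transpose_eq_one h)
  have hmulVec : (Matrix.of fun i a => η a (v i)).mulVec (fun a => η a n) = 0 := funext hn
  have hzero : (fun a => η a n) = 0 := by
    rw [← Matrix.one_mulVec fun a => η a n, ← hinv, ← Matrix.mulVec_mulVec, hmulVec,
      Matrix.mulVec_zero]
  exact congrFun hzero a

end WedgeOfOrthonormal

/-! ### The fibres are minimal and associative -/

/-- The indices of the forms `e¹, …, e⁷` which do not vanish on the fibres of the `j`-th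
projection. -/
def tangentIdx : Fin 3 → Fin 3 → Fin 7 := ![![1, 5, 3], ![2, 6, 3], ![0, 4, 3]]

theorem tangentIdx_injective (j : Fin 3) : Function.Injective (tangentIdx j) := by
  revert j
  decide

theorem sum_eq_sum_tangentIdx (j : Fin 3) {f : Fin 7 → ℝ}
    (hf : ∀ a ∉ Set.range (tangentIdx j), f a = 0) : ∑ a, f a = ∑ s, f (tangentIdx j s) :=
  (Fintype.sum_of_injective _ (tangentIdx_injective j) _ _ hf fun _ => rfl).symm

section Coframe

variable {V : Type*} [AddCommGroup V] [Module ℝ V] [TopologicalSpace V] {k l : ℤ}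
  {A B C D : ℝ} {Ω : Fin 3 → Fin 3 → V →L[ℝ] ℂ} {j : Fin 3}

theorem scaledCoframe_eq_zero_iff (hA : A ≠ 0) (hB : B ≠ 0) (hC : C ≠ 0) (hD : D ≠ 0) (a : Fin 7)
    (v : V) : scaledCoframe k l A B C D Ω a v = 0 ↔ coframe k l Ω a v = 0 := by
  have hscale : (![A, B, C, D, A, B, C] : Fin 7 → ℝ) a ≠ 0 := by
    fin_cases a <;> assumption
  simp [scaledCoframe, hscale]

theorem coframe_tangentIdx (k l : ℤ) (j : Fin 3) (Ω : Fin 3 → Fin 3 → V →L[ℝ] ℂ) (v : V) :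
    coframe k l Ω (tangentIdx j 0) v = √2 * (Ω (j + 1) (j + 2) v).re ∧
      coframe k l Ω (tangentIdx j 1) v = √2 * (Ω (j + 1) (j + 2) v).im ∧
      coframe k l Ω (tangentIdx j 2) v =
        √2 / (6 * sNorm k l) * ∑ i, (coweight k l i : ℝ) * (Ω i i v).im := by
  fin_cases j <;> simp [coframe, tangentIdx]

theorem scaledCoframe_eq_zero_of_off {v : V} (hcol : ∀ i, i ≠ j → Ω i j v = 0)
    (hrow : ∀ i, i ≠ j → Ω j i v = 0) {a : Fin 7} (ha : a ∉ Set.range (tangentIdx j)) :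
    scaledCoframe k l A B C D Ω a v = 0 := by
  suffices coframe k l Ω a v = 0 by simp [scaledCoframe, this]
  fin_cases j
  · have hzero : Ω 0 1 v = 0 ∧ Ω 2 0 v = 0 := ⟨hrow 1 (by decide), hcol 2 (by decide)⟩
    fin_cases a <;> simp [tangentIdx, coframe, hzero] at ha ⊢
  · have hzero : Ω 1 2 v = 0 ∧ Ω 0 1 v = 0 := ⟨hrow 2 (by decide), hcol 0 (by decide)⟩
    fin_cases a <;> simp [tangentIdx, coframe, hzero] at ha ⊢
  · have hzero : Ω 2 0 v = 0 ∧ Ω 1 2 v = 0 := ⟨hrow 0 (by decide), hcol 1 (by decide)⟩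
    fin_cases a <;> simp [tangentIdx, coframe, hzero] at ha ⊢

theorem phiW_eq_neg_wedge {v : Fin 3 → V}
    (hv : ∀ a ∉ Set.range (tangentIdx j), ∀ i, scaledCoframe k l A B C D Ω a (v i) = 0) :
    phiW k l A B C D Ω v =
      -wedge (fun s => scaledCoframe k l A B C D Ω (tangentIdx j s)) v := by
  rw [phiW_eq_g2Form, g2Form, adaptedCoframe]
  generalize scaledCoframe k l A B C D Ω = ε at hv ⊢
  fin_cases j
  · have h0 := hv 0 (by decide)
    have h2 := hv 2 (by decide)
    have h4 := hv 4 (by decide)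
    have h6 := hv 6 (by decide)
    simp [wedge_apply, Matrix.det_fin_three, tangentIdx, h0, h2, h4, h6]
    ring
  · have h0 := hv 0 (by decide)
    have h1 := hv 1 (by decide)
    have h4 := hv 4 (by decide)
    have h5 := hv 5 (by decide)
    simp [wedge_apply, Matrix.det_fin_three, tangentIdx, h0, h1, h4, h5]
    ring
  · have h1 := hv 1 (by decide)
    have h2 := hv 2 (by decide)
    have h5 := hv 5 (by decide)
    have h6 := hv 6 (by decide)
    simp [wedge_apply, Matrix.det_fin_three, tangentIdx, h1, h2, h5, h6]
    ring

end Coframe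

section Commutator

variable {R : Type*} [CommRing R] {P N : Matrix (Fin 3) (Fin 3) R} {j : Fin 3}

theorem commutator_diag_eq_zero (hcol : ∀ i, i ≠ j → P i j = 0) (hrow : ∀ i, i ≠ j → P j i = 0)
    (hN : N (j + 1) (j + 2) = 0) (hN' : N (j + 2) (j + 1) = 0) (i : Fin 3) :
    (N * P - P * N) i i = 0 := by
  fin_cases j <;> fin_cases i <;> simp_all [Matrix.mul_apply, Fin.sum_univ_three, mul_comm]

theorem commutator_add_one_add_two (hcol : ∀ i, i ≠ j → P i j = 0)
    (hrow : ∀ i, i ≠ j → P j i = 0) (hN : N (j + 1) (j + 2) = 0) :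
    (N * P - P * N) (j + 1) (j + 2) =
      (N (j + 1) (j + 1) - N (j + 2) (j + 2)) * P (j + 1) (j + 2) := by
  rw [Matrix.sub_apply, Matrix.mul_apply, Matrix.mul_apply, sum_fin_three_cyclic _ j,
    sum_fin_three_cyclic _ j, hrow (j + 2) (by simp), hcol (j + 1) (by simp), hN]
  ring

end Commutator

section StructureCoefficients

variable {V : Type*} [AddCommGroup V] [Module ℝ V] [TopologicalSpace V] {k l : ℤ} {j : Fin 3}
  {Ω Dp Dn : Fin 3 → Fin 3 → V →L[ℝ] ℂ} {p n : V}

/-- `Dp` and `Dn` stand for the derivatives of `Ω` in the directions `p` and `n`, so that the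
differences are the values `deᵃ(p, n)`. -/
theorem exists_coframe_d_eq_rotation (hskew : ∀ i i', Ω i i' n = -conj (Ω i' i n))
    (hMC : (Matrix.of fun i i' => Dp i i' n) - (Matrix.of fun i i' => Dn i i' p) =
      (Matrix.of fun i i' => Ω i i' n) * (Matrix.of fun i i' => Ω i i' p) -
        (Matrix.of fun i i' => Ω i i' p) * (Matrix.of fun i i' => Ω i i' n))
    (hcol : ∀ i, i ≠ j → Ω i j p = 0) (hrow : ∀ i, i ≠ j → Ω j i p = 0)
    (hn : ∀ s, coframe k l Ω (tangentIdx j s) n = 0) :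
    ∃ c : ℝ,
      coframe k l Dp (tangentIdx j 0) n - coframe k l Dn (tangentIdx j 0) p =
        -c * coframe k l Ω (tangentIdx j 1) p ∧
      coframe k l Dp (tangentIdx j 1) n - coframe k l Dn (tangentIdx j 1) p =
        c * coframe k l Ω (tangentIdx j 0) p ∧
      coframe k l Dp (tangentIdx j 2) n - coframe k l Dn (tangentIdx j 2) p = 0 := by
  have hre (i : Fin 3) : (Ω i i n).re = 0 := by
    have := congrArg Complex.re (hskew i i)
    rw [Complex.neg_re, Complex.conj_re] at this
    linarith
  obtain ⟨n₀, n₁, -⟩ := coframe_tangentIdx k l j Ω n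
  have hsqrt : √2 ≠ 0 := by positivity
  have hplane : Ω (j + 1) (j + 2) n = 0 := Complex.ext
    ((mul_eq_zero.1 (n₀.symm.trans (hn 0))).resolve_left hsqrt)
    ((mul_eq_zero.1 (n₁.symm.trans (hn 1))).resolve_left hsqrt)
  have hplane' : Ω (j + 2) (j + 1) n = 0 := by rw [hskew, hplane, map_zero, neg_zero]
  have hd_plane : Dp (j + 1) (j + 2) n - Dn (j + 1) (j + 2) p =
      (Ω (j + 1) (j + 1) n - Ω (j + 2) (j + 2) n) * Ω (j + 1) (j + 2) p :=
    (congrFun₂ hMC (j + 1) (j + 2)).trans (commutator_add_one_add_two hcol hrow hplane)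
  have hd_diag (i : Fin 3) : Dp i i n - Dn i i p = 0 :=
    (congrFun₂ hMC i i).trans (commutator_diag_eq_zero hcol hrow hplane hplane' i)
  obtain ⟨p₀, p₁, -⟩ := coframe_tangentIdx k l j Ω p
  obtain ⟨dp₀, dp₁, dp₂⟩ := coframe_tangentIdx k l j Dp n
  obtain ⟨dn₀, dn₁, dn₂⟩ := coframe_tangentIdx k l j Dn p
  refine ⟨(Ω (j + 1) (j + 1) n).im - (Ω (j + 2) (j + 2) n).im, ?_, ?_, ?_⟩
  · rw [dp₀, dn₀, p₁, ← mul_sub, ← Complex.sub_re, hd_plane, Complex.mul_re, Complex.sub_re,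
      Complex.sub_im, hre, hre]
    ring
  · rw [dp₁, dn₁, p₀, ← mul_sub, ← Complex.sub_im, hd_plane, Complex.mul_im, Complex.sub_re,
      Complex.sub_im, hre, hre]
    ring
  · simp only [dp₂, dn₂, ← mul_sub, ← Finset.sum_sub_distrib, ← Complex.sub_im, hd_diag,
      Complex.zero_im, mul_zero, Finset.sum_const_zero]

theorem sum_scaledCoframe_mul_d_eq_zero (A B C D : ℝ)
    (hskew : ∀ i i', Ω i i' n = -conj (Ω i' i n))
    (hMC : (Matrix.of fun i i' => Dp i i' n) - (Matrix.of fun i i' => Dn i i' p) =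
      (Matrix.of fun i i' => Ω i i' n) * (Matrix.of fun i i' => Ω i i' p) -
        (Matrix.of fun i i' => Ω i i' p) * (Matrix.of fun i i' => Ω i i' n))
    (hcol : ∀ i, i ≠ j → Ω i j p = 0) (hrow : ∀ i, i ≠ j → Ω j i p = 0)
    (hn : ∀ s, coframe k l Ω (tangentIdx j s) n = 0) :
    ∑ a, scaledCoframe k l A B C D Ω a p *
      (scaledCoframe k l A B C D Dp a n - scaledCoframe k l A B C D Dn a p) = 0 := by
  obtain ⟨c, hd₀, hd₁, hd₂⟩ := exists_coframe_d_eq_rotation hskew hMC hcol hrow hn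
  have hscale : (![A, B, C, D, A, B, C] : Fin 7 → ℝ) (tangentIdx j 1) =
      (![A, B, C, D, A, B, C] : Fin 7 → ℝ) (tangentIdx j 0) := by
    fin_cases j <;> rfl
  rw [sum_eq_sum_tangentIdx j fun a ha => by
    rw [scaledCoframe_eq_zero_of_off hcol hrow ha, zero_mul]]
  simp only [scaledCoframe, smul_apply, smul_eq_mul, ← mul_sub, Fin.sum_univ_three, hd₀, hd₁, hd₂,
    hscale]
  ring

end StructureCoefficients

theorem pullMC_comp {E E' : Type*} [NormedAddCommGroup E] [NormedSpace ℝ E]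
    [NormedAddCommGroup E'] [NormedSpace ℝ E'] {ψ : E → SU3} {u : E' → E} {b : E'}
    (hψ : ∀ i j, DifferentiableAt ℝ (fun y => (ψ y : Matrix (Fin 3) (Fin 3) ℂ) i j) (u b))
    (hu : DifferentiableAt ℝ u b) (i j : Fin 3) (t : E') :
    pullMC (fun b' => ψ (u b')) b i j t = pullMC ψ (u b) i j (fderiv ℝ u b t) := by
  have hcomp := pullMC_apply (fun b' => ψ (u b')) b t
  rw [entryDeriv_comp (F := fun y => (ψ y : Matrix (Fin 3) (Fin 3) ℂ)) hψ hu t] at hcomp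
  exact congrFun₂ (hcomp.trans (pullMC_apply ψ (u b) (fderiv ℝ u b t)).symm) i j

theorem pullMC_eq_zero_of_proj_eventuallyEq {E : Type*} [NormedAddCommGroup E] [NormedSpace ℝ E]
    {f : E → SU3} {b : E} {k l : ℤ} {i j : Fin 3}
    (hf : ∀ i j, DifferentiableAt ℝ (fun y => (f y : Matrix (Fin 3) (Fin 3) ℂ) i j) b)
    (hproj : ∀ᶠ b' in nhds b, proj k l j (f b) = proj k l j (f b')) (hi : i ≠ j) (t : E) :
    pullMC f b i j t = 0 := by
  have hoff : (fun b' => (star (f b : Matrix (Fin 3) (Fin 3) ℂ) * (f b').1) i j)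
      =ᶠ[nhds b] fun _ => 0 := by
    filter_upwards [hproj] with b' hb'
    obtain ⟨c, hc⟩ := proj_mk_eq_iff.1 hb'
    rw [star_mul_apply_of_col_eq_mul hc, Matrix.one_apply_ne hi, mul_zero]
  have hMC := congrFun₂ (pullMC_apply f b t) i j
  have hderiv := congrFun₂ (entryDeriv_mul (F := fun _ => star (f b : Matrix (Fin 3) (Fin 3) ℂ))
    (fun _ _ => differentiableAt_const _) hf t) i j
  rw [entryDeriv_const, zero_mul, zero_add, entryDeriv_apply, hoff.fderiv_eq] at hderiv
  rw [Matrix.of_apply, ← hderiv] at hMC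
  simpa using hMC

section Fibre

variable {k l : ℤ} {A B C D : ℝ} {j : Fin 3} {x : CP2} {ψ : E7 → SU3} {U : Set E7}
  {u : E3 → E7} {O : Set E3} {b : E3}

theorem metricChart_eq_sum (k l : ℤ) (A B C D : ℝ) (ψ : E7 → SU3) :
    metricChart k l A B C D ψ = fun y v w => ∑ a, scaledCoframe k l A B C D (pullMC ψ y) a v *
      scaledCoframe k l A B C D (pullMC ψ y) a w :=
  funext₃ fun _ _ _ => coframeInner_adaptedCoframe k l A B C D _ _ _

theorem contDiffAt_of_isChart (h : IsChart k l ψ U) {y : E7} (hy : y ∈ U) (i i' : Fin 3) :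
    ContDiffAt ℝ ∞ (fun y => (ψ y : Matrix (Fin 3) (Fin 3) ℂ) i i') y :=
  (h.smooth i i').contDiffAt (h.isOpen.mem_nhds hy)

theorem pullMC_col_eq_zero (h : IsParam k l (fibre k l j x) ψ U u O) (hb : b ∈ O) (t : E3)
    {i : Fin 3} (hi : i ≠ j) : pullMC ψ (u b) i j (fderiv ℝ u b t) = 0 := by
  have hψ i i' := (contDiffAt_of_isChart h.isChart (h.mapsTo hb) i i').differentiableAt (by simp)
  have hu := (h.smooth.contDiffAt (h.isOpen.mem_nhds hb)).differentiableAt (by simp)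
  rw [← pullMC_comp hψ hu]
  refine pullMC_eq_zero_of_proj_eventuallyEq (k := k) (l := l)
    (fun i i' => (hψ i i').comp b hu) ?_ hi t
  filter_upwards [h.isOpen.mem_nhds hb] with b' hb'
  exact (h.mem b hb).trans (h.mem b' hb').symm

theorem pullMC_row_eq_zero (h : IsParam k l (fibre k l j x) ψ U u O) (hb : b ∈ O) (t : E3)
    {i : Fin 3} (hi : i ≠ j) : pullMC ψ (u b) j i (fderiv ℝ u b t) = 0 := by
  have hψ i i' := (contDiffAt_of_isChart h.isChart (h.mapsTo hb) i i').differentiableAt (by simp)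
  rw [pullMC_skew hψ, pullMC_col_eq_zero h hb t hi, map_zero, neg_zero]

theorem scaledCoframe_fderiv_eq_zero (h : IsParam k l (fibre k l j x) ψ U u O) (hb : b ∈ O)
    (t : E3) {a : Fin 7} (ha : a ∉ Set.range (tangentIdx j)) :
    scaledCoframe k l A B C D (pullMC ψ (u b)) a (fderiv ℝ u b t) = 0 :=
  scaledCoframe_eq_zero_of_off (fun _ => pullMC_col_eq_zero h hb t)
    (fun _ => pullMC_row_eq_zero h hb t) ha

theorem metricChart_fderiv_eq_sum_tangentIdx (h : IsParam k l (fibre k l j x) ψ U u O)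
    (hb : b ∈ O) (t : E3) (v : E7) :
    metricChart k l A B C D ψ (u b) v (fderiv ℝ u b t) =
      ∑ s, scaledCoframe k l A B C D (pullMC ψ (u b)) (tangentIdx j s) v *
        scaledCoframe k l A B C D (pullMC ψ (u b)) (tangentIdx j s) (fderiv ℝ u b t) := by
  rw [metricChart_eq_sum]
  exact sum_eq_sum_tangentIdx j fun a ha => by
    rw [scaledCoframe_fderiv_eq_zero h hb t ha, mul_zero]

theorem isAssociative_fibre (k l : ℤ) (A B C D : ℝ) (j : Fin 3) (x : CP2) :
    IsAssociative k l A B C D (fibre k l j x) := by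
  intro ψ U u O h b hb t ht
  rw [phiChart, phiW_eq_neg_wedge fun a ha i => scaledCoframe_fderiv_eq_zero h hb (t i) ha, abs_neg]
  exact abs_wedge_eq_one fun i i' =>
    (metricChart_fderiv_eq_sum_tangentIdx h hb (t i') _).symm.trans (ht i i')

theorem coframe_normal_eq_zero (hA : A ≠ 0) (hB : B ≠ 0) (hC : C ≠ 0) (hD : D ≠ 0)
    (h : IsParam k l (fibre k l j x) ψ U u O) (hb : b ∈ O) {t : Fin 3 → E3}
    (ht : IsTangentFrame (metricChart k l A B C D ψ (u b)) u b t) {n : E7}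
    (hn : ∀ i, metricChart k l A B C D ψ (u b) n (fderiv ℝ u b (t i)) = 0) (s : Fin 3) :
    coframe k l (pullMC ψ (u b)) (tangentIdx j s) n = 0 := by
  rw [← scaledCoframe_eq_zero_iff hA hB hC hD]
  refine apply_eq_zero_of_orthogonal
    (η := fun s => scaledCoframe k l A B C D (pullMC ψ (u b)) (tangentIdx j s))
    (v := fun i => fderiv ℝ u b (t i))
    (fun i i' => (metricChart_fderiv_eq_sum_tangentIdx h hb (t i') _).symm.trans (ht i i'))
    (fun i => ?_) s
  rw [← hn i, metricChart_fderiv_eq_sum_tangentIdx h hb]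
  exact Finset.sum_congr rfl fun s _ => mul_comm _ _

theorem isMinimal_fibre (k l : ℤ) (hA : A ≠ 0) (hB : B ≠ 0) (hC : C ≠ 0) (hD : D ≠ 0) (j : Fin 3)
    (x : CP2) : IsMinimal k l A B C D (fibre k l j x) := by
  intro ψ U u O h b hb t ht n hn
  have htwo : (2 : WithTop ℕ∞) ≤ ∞ := WithTop.coe_le_coe.2 le_top
  have hψ i i' : ContDiffAt ℝ 2 (fun y => (ψ y : Matrix (Fin 3) (Fin 3) ℂ) i i') (u b) :=
    (contDiffAt_of_isChart h.isChart (h.mapsTo hb) i i').of_le htwo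
  have hu : ContDiffAt ℝ 2 u b :=
    (h.smooth.contDiffAt (h.isOpen.mem_nhds hb)).of_le htwo
  have hnormal := coframe_normal_eq_zero hA hB hC hD h hb ht hn
  refine Finset.sum_eq_zero fun i _ => ?_
  rw [metricChart_eq_sum, second_fundamental_form_eq_sum_mul_d
    (fun a => (hasFDerivAt_scaledCoframe k l A B C D hψ a).differentiableAt) hu (t i)]
  · simp only [fderiv_scaledCoframe k l A B C D hψ]
    exact sum_scaledCoframe_mul_d_eq_zero A B C D
      (fun i i' => pullMC_skew (fun i i' => (hψ i i').differentiableAt two_ne_zero) i i' n)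
      (fderiv_pullMC_sub_fderiv_pullMC hψ _ n) (fun _ => pullMC_col_eq_zero h hb (t i))
      (fun _ => pullMC_row_eq_zero h hb (t i)) hnormal
  · intro a
    by_cases ha : a ∈ Set.range (tangentIdx j)
    · obtain ⟨s, rfl⟩ := ha
      exact .inl ((scaledCoframe_eq_zero_iff hA hB hC hD _ n).2 (hnormal s))
    · right
      filter_upwards [h.isOpen.mem_nhds hb] with b' hb'
      exact scaledCoframe_fderiv_eq_zero h hb' (t i) ha

end Fibre

/-! ### Spheres of dimension at least two have the lifting property -/

section Lifting

variable {E X : Type*} [TopologicalSpace E] [TopologicalSpace X] {p : E → X}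

theorem exists_lift_of_isOpen_cover {S : Type*} [TopologicalSpace S] (hp : IsCoveringMap p)
    {f : S → X} {U V : Set S} (hU : IsOpen U) (hV : IsOpen V) (hUV : U ∪ V = Set.univ)
    (hconn : IsPreconnected (U ∩ V)) {g₁ g₂ : S → E} (hg₁ : ContinuousOn g₁ U)
    (hg₂ : ContinuousOn g₂ V) (hpg₁ : Set.EqOn (p ∘ g₁) f U) (hpg₂ : Set.EqOn (p ∘ g₂) f V)
    {a : S} (ha : a ∈ U ∩ V) (hga : g₁ a = g₂ a) :
    ∃ g : S → E, Continuous g ∧ p ∘ g = f ∧ Set.EqOn g g₁ U := by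
  classical
  have heq : Set.EqOn g₁ g₂ (U ∩ V) :=
    hp.eqOn_of_comp_eqOn hconn (hg₁.mono Set.inter_subset_left) (hg₂.mono Set.inter_subset_right)
      (fun x hx => (hpg₁ hx.1).trans (hpg₂ hx.2).symm) ha hga
  have hgU : Set.EqOn (U.piecewise g₁ g₂) g₁ U := Set.piecewise_eqOn U g₁ g₂
  have hgV : Set.EqOn (U.piecewise g₁ g₂) g₂ V := fun x hx => by
    by_cases hxU : x ∈ U
    · rw [hgU hxU, heq ⟨hxU, hx⟩]
    · exact Set.piecewise_eq_of_notMem U g₁ g₂ hxU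
  refine ⟨U.piecewise g₁ g₂, ?_, funext fun x => ?_, hgU⟩
  · rw [← continuousOn_univ, ← hUV]
    exact (hg₁.congr hgU).union_of_isOpen (hg₂.congr hgV) hU hV
  · obtain hx | hx : x ∈ U ∨ x ∈ V := hUV.ge (Set.mem_univ x)
    · exact (congrArg p (hgU hx)).trans (hpg₁ hx)
    · exact (congrArg p (hgV hx)).trans (hpg₂ hx)

variable {F : Type*} [NormedAddCommGroup F] [InnerProductSpace ℝ F]

theorem exists_lift_compl_singleton (hp : IsCoveringMap p) {f : Metric.sphere (0 : F) 1 → X}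
    (hf : Continuous f) {v x₀ : Metric.sphere (0 : F) 1} (hx₀ : x₀ ≠ v) {e₀ : E}
    (he₀ : p e₀ = f x₀) :
    ∃ g : Metric.sphere (0 : F) 1 → E, ContinuousOn g {v}ᶜ ∧ Set.EqOn (p ∘ g) f {v}ᶜ ∧
      g x₀ = e₀ := by
  set φ := stereographic (norm_eq_of_mem_sphere v)
  have hsymm : Continuous φ.symm := continuousOn_univ.1 φ.continuousOn_symm
  have hleft {x} (hx : x ≠ v) : φ.symm (φ x) = x := φ.left_inv hx
  obtain ⟨g, ⟨hg₀, hg⟩, -⟩ := hp.existsUnique_continuousMap_lifts ⟨f ∘ φ.symm, hf.comp hsymm⟩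
    (φ x₀) e₀ (he₀.trans (congrArg f (hleft hx₀).symm))
  exact ⟨g ∘ φ, g.continuous.comp_continuousOn φ.continuousOn,
    fun x hx => (congrFun hg (φ x)).trans (congrArg f (hleft hx)), hg₀⟩

theorem preconnectedSpace_sphere (hF : 1 < Module.finrank ℝ F) :
    PreconnectedSpace (Metric.sphere (0 : F) 1) :=
  isPreconnected_iff_preconnectedSpace.1 (isPreconnected_sphere
    (Module.lt_rank_of_lt_finrank (mod_cast hF)) 0 1)

variable [FiniteDimensional ℝ F]

theorem isConnected_compl_poles (hF : 2 < Module.finrank ℝ F) (v : Metric.sphere (0 : F) 1) :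
    IsConnected ({v}ᶜ ∩ {-v}ᶜ) := by
  set φ := stereographic (norm_eq_of_mem_sphere v)
  have hneg : φ (-v) = 0 := stereographic_apply_neg v
  have hne : -v ∈ φ.source := (ne_neg_of_mem_unit_sphere ℝ v).symm
  have himage : {v}ᶜ ∩ {-v}ᶜ = φ.symm '' {0}ᶜ := by
    rw [φ.symm_image_eq_source_inter_preimage (Set.subset_univ _)]
    refine Set.ext fun x => and_congr_right fun hx => not_congr ?_
    rw [Set.mem_singleton_iff, Set.mem_singleton_iff, ← hneg, φ.injOn.eq_iff hx hne]
  have hfinrank : 1 < Module.finrank ℝ (ℝ ∙ (v : F))ᗮ := by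
    have hadd := (ℝ ∙ (v : F)).finrank_add_finrank_orthogonal
    rw [finrank_span_singleton (ne_zero_of_mem_unit_sphere v)] at hadd
    lia
  rw [himage]
  exact (isConnected_compl_singleton_of_one_lt_rank
    (Module.lt_rank_of_lt_finrank (mod_cast hfinrank)) 0).image _
    (φ.continuousOn_symm.mono (Set.subset_univ _))

theorem exists_lift_sphere (hF : 2 < Module.finrank ℝ F) (hp : IsCoveringMap p)
    {f : Metric.sphere (0 : F) 1 → X} (hf : Continuous f) (x₀ : Metric.sphere (0 : F) 1) {e₀ : E}
    (he₀ : p e₀ = f x₀) :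
    ∃ g : Metric.sphere (0 : F) 1 → E, Continuous g ∧ p ∘ g = f ∧ g x₀ = e₀ := by
  have hx₀ : x₀ ≠ -x₀ := ne_neg_of_mem_unit_sphere ℝ x₀
  obtain ⟨a, ha, ha'⟩ := (isConnected_compl_poles hF (-x₀)).nonempty
  obtain ⟨g₁, hg₁, hpg₁, hg₁x₀⟩ := exists_lift_compl_singleton hp hf hx₀ he₀
  obtain ⟨g₂, hg₂, hpg₂, hg₂a⟩ := exists_lift_compl_singleton hp hf ha' (hpg₁ ha)
  have hcover : ({-x₀}ᶜ ∪ {- -x₀}ᶜ : Set (Metric.sphere (0 : F) 1)) = Set.univ := by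
    rw [← Set.compl_inter,
      Set.singleton_inter_eq_empty.2 (show -x₀ ∉ {- -x₀} from ne_neg_of_mem_unit_sphere ℝ (-x₀)),
      Set.compl_empty]
  obtain ⟨g, hg, hpg, hgg₁⟩ := exists_lift_of_isOpen_cover hp isOpen_compl_singleton
    isOpen_compl_singleton hcover (isConnected_compl_poles hF (-x₀)).isPreconnected hg₁ hg₂ hpg₁
    hpg₂ ⟨ha, ha'⟩ hg₂a.symm
  exact ⟨g, hg, hpg, (hgg₁ hx₀).trans hg₁x₀⟩

theorem exists_equiv_lift_of_homeomorph (hF : 2 < Module.finrank ℝ F) {Y₁ Y₂ : Type*}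
    [TopologicalSpace Y₁] [TopologicalSpace Y₂] {q₁ : Metric.sphere (0 : F) 1 → Y₁}
    {q₂ : Metric.sphere (0 : F) 1 → Y₂} (hq₁ : IsCoveringMap q₁) (hq₂ : IsCoveringMap q₂)
    (Φ : Y₁ ≃ₜ Y₂) {x₀ y₀ : Metric.sphere (0 : F) 1} (hy₀ : q₂ y₀ = Φ (q₁ x₀)) :
    ∃ Ψ : Metric.sphere (0 : F) 1 ≃ Metric.sphere (0 : F) 1, ∀ x, q₂ (Ψ x) = Φ (q₁ x) := by
  have := preconnectedSpace_sphere (F := F) (by lia)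
  obtain ⟨f, hf, hqf, hf₀⟩ := exists_lift_sphere hF hq₂ (Φ.continuous.comp hq₁.continuous) x₀ hy₀
  obtain ⟨g, hg, hqg, hg₀⟩ := exists_lift_sphere hF hq₁ (Φ.symm.continuous.comp hq₂.continuous) y₀
    (e₀ := x₀) ((Φ.symm_apply_eq.2 hy₀).symm)
  have hgf : g ∘ f = id := hq₁.eq_of_comp_eq (hg.comp hf) continuous_id
    (by rw [← Function.comp_assoc, hqg, Function.comp_assoc, hqf, ← Function.comp_assoc,
      Φ.symm_comp_self]; rfl) x₀ ((congrArg g hf₀).trans hg₀)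
  have hfg : f ∘ g = id := hq₂.eq_of_comp_eq (hf.comp hg) continuous_id
    (by rw [← Function.comp_assoc, hqf, Function.comp_assoc, hqg, ← Function.comp_assoc,
      Φ.self_comp_symm]; rfl) y₀ ((congrArg f hg₀).trans hf₀)
  exact ⟨⟨f, g, congrFun hgf, congrFun hfg⟩, congrFun hqf⟩

theorem natCard_eq_of_homeomorph_of_isQuotientCoveringMap_sphere (hF : 2 < Module.finrank ℝ F)
    {Y₁ Y₂ G₁ G₂ : Type*} [TopologicalSpace Y₁] [TopologicalSpace Y₂] [Group G₁] [Group G₂]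
    [MulAction G₁ (Metric.sphere (0 : F) 1)] [MulAction G₂ (Metric.sphere (0 : F) 1)]
    {q₁ : Metric.sphere (0 : F) 1 → Y₁} {q₂ : Metric.sphere (0 : F) 1 → Y₂}
    (hq₁ : IsQuotientCoveringMap q₁ G₁) (hq₂ : IsQuotientCoveringMap q₂ G₂) (Φ : Y₁ ≃ₜ Y₂) :
    Nat.card G₁ = Nat.card G₂ := by
  have : Nontrivial F := Module.nontrivial_of_finrank_pos (R := ℝ) (by lia)
  obtain ⟨x₀⟩ := ((NormedSpace.sphere_nonempty (x := (0 : F))).2 zero_le_one).to_subtype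
  obtain ⟨y₀, hy₀⟩ := hq₂.surjective (Φ (q₁ x₀))
  obtain ⟨Ψ, hΨ⟩ :=
    exists_equiv_lift_of_homeomorph hF hq₁.isCoveringMap hq₂.isCoveringMap Φ hy₀
  have e : q₁ ⁻¹' {q₁ x₀} ≃ q₂ ⁻¹' {q₂ y₀} := Ψ.subtypeEquiv fun x => by
    simp only [Set.mem_preimage, Set.mem_singleton_iff, hΨ, hy₀, Φ.injective.eq_iff]
  calc Nat.card G₁ = Nat.card (q₁ ⁻¹' {q₁ x₀}) :=
        (Nat.card_congr (hq₁.fiberEquivGroup ⟨x₀, rfl⟩)).symm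
    _ = Nat.card (q₂ ⁻¹' {q₂ y₀}) := Nat.card_congr e
    _ = Nat.card G₂ := Nat.card_congr (hq₂.fiberEquivGroup ⟨y₀, rfl⟩)

end Lifting

/-! ### The three families are different -/

theorem exists_block_apply_self_eq_zero {i j : Fin 3} (hij : i ≠ j) :
    ∃ x : S3, (block i x).1 j j = 0 := by
  refine ⟨⟨EuclideanSpace.single 2 1, by simp⟩, ?_⟩
  have hrelabel : relabel i j ≠ 2 := fun h =>
    hij ((relabel i).injective ((relabel_self i).trans h.symm))
  have hfst : cplxFst (EuclideanSpace.single 2 1) = 0 :=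
    Complex.ext (by simp [cplxFst_apply]) (by simp [cplxFst_apply])
  change cyc i (blockMatrix (EuclideanSpace.single 2 1)) j j = 0
  rw [cyc_apply, blockMatrix_eq]
  generalize relabel i j = r at hrelabel
  fin_cases r
  · simp [hfst]
  · simp [hfst]
  · exact absurd rfl hrelabel

/-- The action of `SU(2)_i` moves the `j`-th column of a matrix, so that `π_j` is not constant on
the fibres of `π_i`. -/
theorem fibre_ne_fibre (k l : ℤ) {i j : Fin 3} (hij : i ≠ j) (x y : CP2) :
    fibre k l i x ≠ fibre k l j y := by
  intro h
  obtain ⟨a, rfl⟩ := exists_linePoint_zero_eq i x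
  rw [linePoint_zero k l] at h
  obtain ⟨z, hz⟩ := exists_block_apply_self_eq_zero hij
  have ha : proj k l j a = y := h.subset (show proj k l i a = proj k l i a from rfl)
  have haz : proj k l j (a * block i z : SU3) = y := h.subset (proj_mk_mul_block k l i a z)
  obtain ⟨c, hc⟩ := proj_mk_eq_iff.1 (ha.trans haz.symm)
  have hc0 : c = 0 := by
    have hjj := star_mul_apply_of_col_eq_mul hc j
    rw [Submonoid.coe_mul, ← mul_assoc, star_coe_mul_coe, one_mul, hz, Matrix.one_apply_eq,
      mul_one] at hjj
    exact hjj.symm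
  exact zero_ne_one (norm_eq_one_of_col_eq_mul hc ▸ (norm_eq_zero.2 hc0).symm)

/-! ### The fibres as quotients of `S³` -/

theorem norm_rootsOfUnity {p : ℕ} [NeZero p] (ζ : rootsOfUnity p ℂ) : ‖((ζ : ℂˣ) : ℂ)‖ = 1 :=
  Complex.norm_eq_one_of_pow_eq_one ((mem_rootsOfUnity' p _).1 ζ.2) (NeZero.ne p)

/-- The action of the `p`-th roots of unity on `S³ ⊂ ℂ²` by multiplication. -/
instance rootsOfUnityAction (p : ℕ) [NeZero p] : MulAction (rootsOfUnity p ℂ) S3 where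
  smul ζ x := ⟨cmul ((ζ : ℂˣ) : ℂ) x.1, by
    rw [mem_sphere_zero_iff_norm, norm_cmul, norm_rootsOfUnity, one_mul, norm_eq_of_mem_sphere]⟩
  one_smul x := Subtype.ext (one_cmul x.1)
  mul_smul ζ ξ x := Subtype.ext (mul_cmul ((ζ : ℂˣ) : ℂ) ((ξ : ℂˣ) : ℂ) x.1)

theorem coe_rootsOfUnity_smul {p : ℕ} [NeZero p] (ζ : rootsOfUnity p ℂ) (x : S3) :
    (ζ • x).1 = cmul ((ζ : ℂˣ) : ℂ) x.1 := rfl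

instance continuousConstSMul_sphere (p : ℕ) [NeZero p] :
    ContinuousConstSMul (rootsOfUnity p ℂ) S3 where
  continuous_const_smul ζ :=
    ((continuous_cmul ((ζ : ℂˣ) : ℂ)).comp continuous_subtype_val).subtype_mk _

instance isCancelSMul_sphere (p : ℕ) [NeZero p] : IsCancelSMul (rootsOfUnity p ℂ) S3 := by
  rw [isCancelSMul_iff_eq_one_of_smul_eq]
  intro ζ x h
  have hnorm := norm_cmul_sub_self ((ζ : ℂˣ) : ℂ) x.1
  rw [← coe_rootsOfUnity_smul, h, sub_self, norm_zero, norm_eq_of_mem_sphere, mul_one, eq_comm,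
    norm_eq_zero, sub_eq_zero] at hnorm
  exact Subtype.ext (Units.ext hnorm)

theorem sameOrbit_iff_mem_orbit {p : ℕ} [NeZero p] {x y : S3} :
    SameOrbit p x y ↔ y ∈ MulAction.orbit (rootsOfUnity p ℂ) x := by
  rw [sameOrbit_iff_exists_cmul]
  constructor
  · rintro ⟨ζ, hζ, hy⟩
    exact ⟨rootsOfUnity.mkOfPowEq ζ hζ, Subtype.ext hy.symm⟩
  · rintro ⟨ζ, rfl⟩
    exact ⟨((ζ : ℂˣ) : ℂ), (mem_rootsOfUnity' p _).1 ζ.2, rfl⟩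

instance isTopologicalGroup_SU3 : IsTopologicalGroup SU3 where
  continuous_inv := (continuous_subtype_val.star : Continuous fun g : SU3 =>
    star (g : Matrix (Fin 3) (Fin 3) ℂ)).subtype_mk _

theorem continuous_circleElt (k l : ℤ) : Continuous (circleElt k l) :=
  (Continuous.matrix_diagonal (continuous_pi fun i => by unfold phase; fun_prop)).subtype_mk _

theorem periodic_circleElt (k l : ℤ) : Function.Periodic (circleElt k l) (2 * Real.pi) := by
  refine fun θ => Subtype.ext (congrArg Matrix.diagonal (funext fun i => ?_))
  rw [phase, phase, Complex.exp_eq_exp_iff_exists_int]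
  refine ⟨weight k l i, ?_⟩
  push_cast
  ring

theorem isClosed_circle (k l : ℤ) : IsClosed (circle k l : Set SU3) := by
  have hrange : (circle k l : Set SU3) = Set.range (circleElt k l) :=
    Set.ext fun h => exists_congr fun θ =>
      ⟨fun h' => Subtype.ext h'.symm, fun h' => congrArg Subtype.val h'.symm⟩
  rw [hrange]
  exact ((periodic_circleElt k l).compact_of_continuous (by positivity)
    (continuous_circleElt k l)).isClosed

instance t2Space_W (k l : ℤ) : T2Space (W k l) :=
  have := isClosed_circle k l
  QuotientGroup.instT2Space

theorem continuous_block (j : Fin 3) : Continuous (block j) :=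
  Continuous.subtype_mk (continuous_matrix fun _ _ =>
    ((contDiff_blockMatrix _ _).continuous.comp continuous_subtype_val)) _

theorem exists_isQuotientCoveringMap_fibre {k l : ℤ} (hkl : IsCoprime k l) {j : Fin 3}
    (hw : weight k l j ≠ 0) [NeZero (weight k l j).natAbs] (x : CP2) :
    ∃ q : S3 → fibre k l j x, IsQuotientCoveringMap q (rootsOfUnity (weight k l j).natAbs ℂ) := by
  obtain ⟨a, rfl⟩ := exists_linePoint_zero_eq j x
  rw [linePoint_zero k l]
  let q : S3 → fibre k l j (proj k l j a) := fun y =>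
    ⟨(a * block j y : SU3), proj_mk_mul_block k l j a y⟩
  have hq : Continuous q := (continuous_quotient_mk'.comp
    ((continuous_block j).const_mul a)).subtype_mk _
  have hsurj : Function.Surjective q := fun ⟨y, hy⟩ => by
    obtain ⟨z, hz⟩ := (fibre_proj_mk hw a).subset hy
    exact ⟨z, Subtype.ext hz⟩
  have hquot : Topology.IsQuotientMap q := hq.isClosedMap.isQuotientMap hq hsurj
  refine ⟨q, hquot.isQuotientCoveringMap_of_properlyDiscontinuousSMul fun {y z} => ?_⟩
  rw [← sameOrbit_iff_mem_orbit, ← mk_mul_block_eq_iff hkl hw a, eq_comm, Subtype.ext_iff]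

theorem isEmpty_homeomorph_fibre {k l : ℤ} (hkl : IsCoprime k l) (hw : ∀ j, weight k l j ≠ 0)
    {i j : Fin 3} (hij : |weight k l i| ≠ |weight k l j|) (x y : CP2) :
    IsEmpty (fibre k l i x ≃ₜ fibre k l j y) := by
  refine ⟨fun Φ => hij ?_⟩
  have : NeZero (weight k l i).natAbs := ⟨Int.natAbs_ne_zero.2 (hw i)⟩
  have : NeZero (weight k l j).natAbs := ⟨Int.natAbs_ne_zero.2 (hw j)⟩
  obtain ⟨q₁, hq₁⟩ := exists_isQuotientCoveringMap_fibre hkl (hw i) x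
  obtain ⟨q₂, hq₂⟩ := exists_isQuotientCoveringMap_fibre hkl (hw j) y
  have hcard := natCard_eq_of_homeomorph_of_isQuotientCoveringMap_sphere (by simp) hq₁ hq₂ Φ
  rw [Complex.card_rootsOfUnity, Complex.card_rootsOfUnity] at hcard
  rw [Int.abs_eq_natAbs, Int.abs_eq_natAbs, hcard]

end AloffWallach

end

theorem mainTheorem10_general {k l : ℤ} (hkl : IsCoprime k l)
    (hw : ∀ j, AloffWallach.weight k l j ≠ 0)
    {A B C D : ℝ} (hA : A ≠ 0) (hB : B ≠ 0) (hC : C ≠ 0) (hD : D ≠ 0) :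
    (∀ x : AloffWallach.CP2,
      AloffWallach.IsEmbeddedThreefold k l (AloffWallach.fibre k l 2 x) ∧
      AloffWallach.IsMinimal k l A B C D (AloffWallach.fibre k l 2 x) ∧
      AloffWallach.IsAssociative k l A B C D (AloffWallach.fibre k l 2 x)) ∧
    (∀ j : Fin 3,
      AloffWallach.IsSpaceFormFamily k l (AloffWallach.weight k l j).natAbs
        (AloffWallach.fibre k l j) ∧
      ∀ x : AloffWallach.CP2,
        AloffWallach.IsEmbeddedThreefold k l (AloffWallach.fibre k l j x) ∧
        AloffWallach.IsMinimal k l A B C D (AloffWallach.fibre k l j x) ∧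
        AloffWallach.IsAssociative k l A B C D (AloffWallach.fibre k l j x)) ∧
    (∀ i j : Fin 3, i ≠ j → ∀ x y : AloffWallach.CP2,
      AloffWallach.fibre k l i x ≠ AloffWallach.fibre k l j y) ∧
    (Function.Injective (fun j : Fin 3 => |AloffWallach.weight k l j|) →
      ∀ i j : Fin 3, i ≠ j → ∀ x y : AloffWallach.CP2,
        IsEmpty (AloffWallach.fibre k l i x ≃ₜ AloffWallach.fibre k l j y)) := by
  have hfibre (j : Fin 3) (x : AloffWallach.CP2) :
      AloffWallach.IsEmbeddedThreefold k l (AloffWallach.fibre k l j x) ∧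
      AloffWallach.IsMinimal k l A B C D (AloffWallach.fibre k l j x) ∧
      AloffWallach.IsAssociative k l A B C D (AloffWallach.fibre k l j x) :=
    ⟨AloffWallach.isEmbeddedThreefold_fibre hkl (hw j) x,
      AloffWallach.isMinimal_fibre k l hA hB hC hD j x,
      AloffWallach.isAssociative_fibre k l A B C D j x⟩
  exact ⟨hfibre 2, fun j => ⟨AloffWallach.isSpaceFormFamily_fibre hkl (hw j), hfibre j⟩,
    fun _ _ hij x y => AloffWallach.fibre_ne_fibre k l hij x y,
    fun hinj _ _ hij x y => AloffWallach.isEmpty_homeomorph_fibre hkl hw (hinj.ne hij) x y⟩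

theorem mainTheorem10 (k l : ℤ) (hk : k ≠ 0) (hl : l ≠ 0) (hkl : IsCoprime k l)
    (hgen₁ : ({k, l, -k - l} : Multiset ℤ) ≠ {1, 1, -2})
    (hgen₂ : ({k, l, -k - l} : Multiset ℤ) ≠ {1, -1, 0})
    (A B C D : ℝ) (hA : A ≠ 0) (hB : B ≠ 0) (hC : C ≠ 0) (hD : D ≠ 0)
    (hnp : AloffWallach.IsNearlyParallel k l A B C D) :
    -- the fibres of the canonical fibration are embedded minimal associative 3-folds
    (∀ x : AloffWallach.CP2,
      AloffWallach.IsEmbeddedThreefold k l (AloffWallach.fibre k l 2 x) ∧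
      AloffWallach.IsMinimal k l A B C D (AloffWallach.fibre k l 2 x) ∧
      AloffWallach.IsAssociative k l A B C D (AloffWallach.fibre k l 2 x)) ∧
    -- there are three 4-dimensional families of minimal associative spherical space forms
    (∀ j : Fin 3,
      AloffWallach.IsSpaceFormFamily k l (AloffWallach.weight k l j).natAbs
        (AloffWallach.fibre k l j) ∧
      ∀ x : AloffWallach.CP2,
        AloffWallach.IsEmbeddedThreefold k l (AloffWallach.fibre k l j x) ∧
        AloffWallach.IsMinimal k l A B C D (AloffWallach.fibre k l j x) ∧
        AloffWallach.IsAssociative k l A B C D (AloffWallach.fibre k l j x)) ∧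
    -- the three families are different: they have no common members
    (∀ i j : Fin 3, i ≠ j → ∀ x y : AloffWallach.CP2,
      AloffWallach.fibre k l i x ≠ AloffWallach.fibre k l j y) ∧
    -- for `|k|, |l|, |m|` pairwise distinct, their members are not even homeomorphic
    (Function.Injective (fun j : Fin 3 => |AloffWallach.weight k l j|) →
      ∀ i j : Fin 3, i ≠ j → ∀ x y : AloffWallach.CP2,
        IsEmpty (AloffWallach.fibre k l i x ≃ₜ AloffWallach.fibre k l j y)) :=
  mainTheorem10_general hkl (AloffWallach.weight_ne_zero hk hl hkl hgen₂) hA hB hC hD
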